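/- Work in the black-box (decision tree) model. A search problem with $n$ input bits is a relation $R\subseteq\{0,1\}^n\times O$; it is total if every $x$ has some $o$ with $(x,o)\in R$. For problems $R\subseteq\{0,1\}^n\times O$ and $S\subseteq\{0,1\}^m\times O'$, an $S$-formulation of $R$ of depth $d$ consists of functions $f_i:\{0,1\}^n\to\{0,1\}$ ($i\in[m]$) and $g_o:\{0,1\}^n\to O$ ($o\in O'$), each computed by a decision tree of depth at most $d$, such that $(f(x),o)\in S$ implies $(x,g_o(x))\in R$; its complexity is $\log m+d$. For families $R,S$ of problems, $R\le_{dt}S$ means that every member of $R$ with $n$ input bits has a formulation of complexity $\mathrm{poly}(\log n)$ by some member of $S$. The polynomial may depend only on the two families. Integers in $[M]=\{0,\dots,M-1\}$ are encoded in binary with $\lceil\log_2 M\rceil$ bits, and an encoded function value that falls outside its range counts as undefined: every equation or membership involving it is regarded as violated. Lossy-Code, for $N\ge 1$: given $f:[N]\to[2N]$ and $g:[2N]\to[N]$, find $y\in[2N]$ with $f(g(y))\ne y$. $\mathsf{Lossy}$ is the class of families of total search problems $R$ with $R\le_{dt}$ Lossy-Code; a family $R$ is $\mathsf{Lossy}$-complete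 if $R\in\mathsf{Lossy}$ and $S\le_{dt}R$ for every $S\in\mathsf{Lossy}$. $c$-AMGM-LC, for $N\ge1$: let $V=[2N]$, $P=[\lceil cN^2\rceil]$. Given $C:V\to\{0,1\}$, $F:P\to V\times V$ and $G:V\times V\to P$, find $p\in P$ such that $G(F(p))\neq p$ or $F(p)\notin C^{-1}(0)\times C^{-1}(1)$. $c$-Dual-AMGM-LC, for $N\ge1$: let $V=[2N]$, $H=[\lfloor cN^2\rfloor]$. Given $C:V\to\{0,1\}$, $F:H\to V\times V$ and $G:V\times V\to H$, find $(u,v)\in V\times V$ with $C(u)=C(v)$ and $F(G(u,v))\ne(u,v)$. Inclusion-Exclusion with constants $C,k\ge1$ has as parameters $N,\ell\in\mathbb N$ and $\varepsilon\in\mathbb R$ with $\ell\le C(\log_2N)^k$ and $1<\varepsilon\cdot C(\log_2N)^k$. The input consists of a table $T\in\{0,1\}^{[\ell]\times[N]}$ (with $S_i=\{y:T_{i,y}=1\}$); numbers $0\le a_i\le N$ ($i\in[\ell]$) and $0\le a_{i,j}\le N$ ($i<j$) such that $\tilde a:=\sum_i a_i-\sum_{i<j}a_{i,j}$ satisfies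 $\tilde a\ge\varepsilon N$ (on inputs that violate these assumptions every output is accepted); and maps $f_i:[a_i]\to[N]$, $g_i:[N]\to[a_i]$, $f_{i,j}:[a_{i,j}]\to[N]$, $g_{i,j}:[N]\to[a_{i,j}]$, and, with $L=\lfloor\tilde a-\varepsilon N\rfloor$, $\tilde f:[L]\to[N]$, $\tilde g:[N]\to[L]$. Here $f_i$ and $f_{i,j}$ are given by tables with $N$ rows, and $\tilde f$ by a table with $\ell N$ rows, in which only the initial rows are used; the values of $g_i$ and $g_{i,j}$ are encoded as elements of $[N]$, and those of $\tilde g$ as elements of $[\ell N]$. A solution is one of: (s1) $i$ and $x\in[a_i]$ with $T_{i,f_i(x)}=0$ or $g_i(f_i(x))\ne x$; (s2) $i<j$ and $x\in S_i\cap S_j$ with $f_{i,j}(g_{i,j}(x))\ne x$; (s3) $x\in\bigcup_iS_i$ with $\tilde f(\tilde g(x))\neq x$. **Theorem.** The following families are $\mathsf{Lossy}$-complete: (1) $c$-AMGM-LC, for every real constant $c>1$; (2) $c$-Dual-AMGM-LC, for every real constant $0<c<2$; (3) Inclusion-Exclusion, for all integer constants $C,k\ge1$. -/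

import Mathlib

/-! ### Query search problems and decision tree reductions -/

/-- A (query) search problem `R ⊆ {0,1}ⁿ × O`; the `n` input bits are indexed by `Pos`. -/
structure SearchProblem where
  Pos : Type
  [fintypePos : Fintype Pos]
  Out : Type
  Rel : (Pos → Bool) → Out → Prop

namespace SearchProblem

/-- The number `n` of input bits. -/
def inputLength (R : SearchProblem) : ℕ :=
  letI := R.fintypePos
  Fintype.card R.Pos

/-- Every input has a solution. -/
def Total (R : SearchProblem) : Prop :=
  ∀ x, ∃ o, R.Rel x o

end SearchProblem

/-- Decision trees querying single bits of an input in `{0,1}^Q`, with leaves labelled in `A`. -/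
inductive DecisionTree (Q A : Type) : Type
  | leaf (a : A) : DecisionTree Q A
  | query (q : Q) (ifFalse ifTrue : DecisionTree Q A) : DecisionTree Q A

namespace DecisionTree

/-- The label of the leaf reached on input `x`. -/
def eval {Q A : Type} (x : Q → Bool) : DecisionTree Q A → A
  | leaf a => a
  | query q t₀ t₁ => bif x q then eval x t₁ else eval x t₀

/-- The largest number of queries on a path from the root to a leaf. -/
def depth {Q A : Type} : DecisionTree Q A → ℕ
  | leaf _ => 0
  | query _ t₀ t₁ => max (depth t₀) (depth t₁) + 1

end DecisionTree

/-- The function `h` is computed by a decision tree of depth at most `d`. -/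
def HasDepthLE {Q A : Type} (h : (Q → Bool) → A) (d : ℕ) : Prop :=
  ∃ t : DecisionTree Q A, t.depth ≤ d ∧ ∀ x, t.eval x = h x

/-- An `S`-formulation of `R`. -/
structure Formulation (R S : SearchProblem) where
  f : S.Pos → (R.Pos → Bool) → Bool
  g : S.Out → (R.Pos → Bool) → R.Out
  correct : ∀ (x : R.Pos → Bool) (o : S.Out), S.Rel (fun i => f i x) o → R.Rel x (g o x)

/-- The formulation has depth at most `d`. -/
def Formulation.DepthLE {R S : SearchProblem} (F : Formulation R S) (d : ℕ) : Prop :=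
  (∀ i, HasDepthLE (F.f i) d) ∧ ∀ o, HasDepthLE (F.g o) d

/-- There is an `S`-formulation of `R` of complexity (`log₂` of the number of input bits of `S`,
plus depth) at most `b`. -/
def ReducesWithComplexity (R S : SearchProblem) (b : ℕ) : Prop :=
  ∃ (F : Formulation R S) (d : ℕ), F.DepthLE d ∧ Nat.log 2 S.inputLength + d ≤ b

/-- `R ≤_dt S` for families of search problems: every member of `R`, with `n` input bits, reduces
to some member of `S` with complexity `poly(log n)`. -/
def ReducesDT {ι κ : Type} (R : ι → SearchProblem) (S : κ → SearchProblem) : Prop :=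
  ∃ C k : ℕ, ∀ i : ι, ∃ j : κ,
    ReducesWithComplexity (R i) (S j) (C * (Nat.log 2 (R i).inputLength + 1) ^ k)

/-! ### Tables

A table of numbers smaller than `M` stores each entry in `Nat.clog 2 M = ⌈log₂ M⌉` bits. If `M` is
not a power of two, an entry may fail to be smaller than `M`; the problems below treat such an entry
as undefined, so that it violates every requirement it takes part in. -/

/-- Bit positions of a table with rows `A` and entries smaller than `M`. -/
abbrev TablePos (A : Type) (M : ℕ) : Type := A × Fin (Nat.clog 2 M)

/-- The entry of a table in row `a`, read in binary (least significant bit first). -/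
def tableEntry {A : Type} {M : ℕ} (t : TablePos A M → Bool) (a : A) : ℕ :=
  Nat.ofBits fun b => t (a, b)

/-! ### Lossy-Code -/

namespace LossyCode

/-- Input bits for `f : [N] → [2N]` and `g : [2N] → [N]`. -/
abbrev Pos (N : ℕ) : Type := TablePos (Fin N) (2 * N) ⊕ TablePos (Fin (2 * N)) N

def f {N : ℕ} (x : Pos N → Bool) : Fin N → ℕ := tableEntry fun p => x (.inl p)

def g {N : ℕ} (x : Pos N → Bool) : Fin (2 * N) → ℕ := tableEntry fun p => x (.inr p)

end LossyCode

/-- Lossy-Code with stretch `N → 2N`: find `y ∈ [2N]` with `f (g y) ≠ y`. -/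
def lossyCode (N : ℕ+) : SearchProblem where
  Pos := LossyCode.Pos N
  Out := Fin (2 * N)
  Rel x y := ¬ ∃ z : Fin N, LossyCode.g x y = z ∧ LossyCode.f x z = y

/-- The class `Lossy` of total search problems reducible to Lossy-Code. -/
def InLossy {ι : Type} (R : ι → SearchProblem) : Prop :=
  (∀ i, (R i).Total) ∧ ReducesDT R lossyCode

/-- Completeness for the class `Lossy` under efficient decision tree reductions. -/
def LossyComplete {ι : Type} (R : ι → SearchProblem) : Prop :=
  InLossy R ∧ ∀ (κ : Type) (S : κ → SearchProblem), InLossy S → ReducesDT S R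

/-! ### AMGM-LC and Dual-AMGM-LC -/

/-- Input bits for a coloring `C : [2N] → {0,1}` and maps `F : [K] → [2N] × [2N]` (two tables, one
for each component) and `G : [2N] × [2N] → [K]`. -/
inductive ColoringPos (N K : ℕ) : Type
  | color (v : Fin (2 * N))
  | fst (p : TablePos (Fin K) (2 * N))
  | snd (p : TablePos (Fin K) (2 * N))
  | back (p : TablePos (Fin (2 * N) × Fin (2 * N)) K)
  deriving Fintype

namespace ColoringPos

variable {N K : ℕ} (x : ColoringPos N K → Bool)

def C (v : Fin (2 * N)) : Bool := x (.color v)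

def F (p : Fin K) : ℕ × ℕ :=
  (tableEntry (fun q => x (.fst q)) p, tableEntry (fun q => x (.snd q)) p)

def G (w : Fin (2 * N) × Fin (2 * N)) : ℕ := tableEntry (fun q => x (.back q)) w

end ColoringPos

/-- `c`-AMGM-LC with vertices `V = [2N]` and pigeons `P = [⌈cN²⌉]`. A solution is a pigeon `p` that
violates `F p ∈ C⁻¹(0) × C⁻¹(1)` or `G (F p) = p`. -/
noncomputable def amgmLC (c : ℝ) (N : ℕ+) : SearchProblem where
  Pos := ColoringPos N ⌈c * (N : ℝ) ^ 2⌉₊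
  Out := Fin ⌈c * (N : ℝ) ^ 2⌉₊
  Rel x p := ¬ ∃ u v : Fin (2 * N), ColoringPos.F x p = ((u : ℕ), (v : ℕ)) ∧
    (ColoringPos.C x u = false ∧ ColoringPos.C x v = true) ∧ ColoringPos.G x (u, v) = p

/-- `c`-Dual-AMGM-LC with vertices `V = [2N]` and holes `H = [⌊cN²⌋]`. A solution is a
monochromatic pair `w = (u, v)` with `F (G w) ≠ w`. -/
noncomputable def dualAmgmLC (c : ℝ) (N : ℕ+) : SearchProblem where
  Pos := ColoringPos N ⌊c * (N : ℝ) ^ 2⌋₊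
  Out := Fin (2 * N) × Fin (2 * N)
  Rel x w := ColoringPos.C x w.1 = ColoringPos.C x w.2 ∧
    ¬ ∃ h : Fin ⌊c * (N : ℝ) ^ 2⌋₊,
      ColoringPos.G x w = h ∧ ColoringPos.F x h = ((w.1 : ℕ), (w.2 : ℕ))

/-! ### Inclusion-Exclusion -/

/-- Index pairs `i < j`. -/
abbrev IndexPair (l : ℕ) : Type := {p : Fin l × Fin l // p.1 < p.2}

/-- The parameters `N`, `ℓ ≤ C (log₂ N)^k` and `ε > 1 / (C (log₂ N)^k)`; the last condition is
written as a product. -/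
structure InclExclParam (C k : ℕ) : Type where
  N : ℕ
  l : ℕ
  ε : ℝ
  l_le : (l : ℝ) ≤ C * Real.logb 2 N ^ k
  lt_ε : 1 < ε * (C * Real.logb 2 N ^ k)

/-- Input bits of Inclusion-Exclusion: the table `T`, the numbers `a_i, a_{i,j}`, and the purported
injection-surjection pairs. Since `a_i` is itself part of the input, `f_i : [a_i] → [N]` is given
by a table with `N` rows of which only the first `a_i` matter; similarly for `f_{i,j}`, and for
`f̃ : [ã - εN] → [N]`, where `ã ≤ ℓN`. -/
inductive InclExclPos (N l : ℕ) : Type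
  | mem (i : Fin l) (y : Fin N)
  | card (p : TablePos (Fin l) (N + 1))
  | cardInter (p : TablePos (IndexPair l) (N + 1))
  | single (p : TablePos (Fin l × Fin N) N)
  | singleBack (p : TablePos (Fin l × Fin N) N)
  | inter (p : TablePos (IndexPair l × Fin N) N)
  | interBack (p : TablePos (IndexPair l × Fin N) N)
  | union (p : TablePos (Fin (l * N)) N)
  | unionBack (p : TablePos (Fin N) (l * N))
  deriving Fintype

namespace InclExclPos

variable {N l : ℕ} (x : InclExclPos N l → Bool)

/-- `y ∈ S_i`. -/
def T (i : Fin l) (y : Fin N) : Prop := x (.mem i y) = true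

def a (i : Fin l) : ℕ := tableEntry (fun q => x (.card q)) i

def a₂ (p : IndexPair l) : ℕ := tableEntry (fun q => x (.cardInter q)) p

def f (i : Fin l) (y : Fin N) : ℕ := tableEntry (fun q => x (.single q)) (i, y)

def g (i : Fin l) (y : Fin N) : ℕ := tableEntry (fun q => x (.singleBack q)) (i, y)

def f₂ (p : IndexPair l) (y : Fin N) : ℕ := tableEntry (fun q => x (.inter q)) (p, y)

def g₂ (p : IndexPair l) (y : Fin N) : ℕ := tableEntry (fun q => x (.interBack q)) (p, y)

def fUnion (z : Fin (l * N)) : ℕ := tableEntry (fun q => x (.union q)) z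

def gUnion (y : Fin N) : ℕ := tableEntry (fun q => x (.unionBack q)) y

/-- `ã = ∑ a_i - ∑_{i<j} a_{i,j}`. -/
def aTilde : ℤ := ∑ i, (a x i : ℤ) - ∑ p, (a₂ x p : ℤ)

/-- The assumptions on the numbers in the input. -/
def Valid (ε : ℝ) : Prop :=
  (∀ i, a x i ≤ N) ∧ (∀ p, a₂ x p ≤ N) ∧ ε * N ≤ (aTilde x : ℝ)

end InclExclPos

open InclExclPos in
/-- Inclusion-Exclusion. The three kinds of outputs are the three types of solutions:
a violation `y ∈ [a_i]` of `|S_i| ≥ a_i`, a violation `y ∈ [N]` of `|S_i ∩ S_j| ≤ a_{i,j}`, and a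
violation `y ∈ [N]` of `|⋃ S_i| ≤ ã - εN`. On inputs that do not satisfy the assumptions every
output is accepted. -/
noncomputable def inclusionExclusion (C k : ℕ) (P : InclExclParam C k) : SearchProblem where
  Pos := InclExclPos P.N P.l
  Out := (Fin P.l × Fin P.N) ⊕ (IndexPair P.l × Fin P.N) ⊕ Fin P.N
  Rel x o := Valid x P.ε → match o with
    | .inl (i, y) => (y : ℕ) < a x i ∧
        ¬ ∃ z : Fin P.N, f x i y = z ∧ T x i z ∧ g x i z = y
    | .inr (.inl (p, y)) => (T x p.1.1 y ∧ T x p.1.2 y) ∧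
        ¬ ∃ z : Fin P.N, (z : ℕ) < a₂ x p ∧ g₂ x p y = z ∧ f₂ x p z = y
    | .inr (.inr y) => (∃ i, T x i y) ∧
        ¬ ∃ z : Fin (P.l * P.N), (z : ℕ) < ⌊(aTilde x : ℝ) - P.ε * P.N⌋₊ ∧
          gUnion x y = z ∧ fUnion x z = y

/-! ### Closure properties of shallow decision trees -/

/-! Everything passes through one notion, `HasRetraction R A B d`: shallow partial maps `f : A → B`
and `g : B → A` such that any `y` in `B` with `f (g y) ≠ y` yields a solution of `R`. If `2|A| ≤
|B|` and `2 ≤ |B|`, this puts `R` below Lossy-Code and forces totality by counting. Lossy-Code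
itself is a retraction from `N` to `2N`. Retractions tolerate a larger `A` and a smaller `B`, and
they have powers (`HasRetractionOn.pow`): passing to `t`-tuples raises both sizes to the power `t`,
so a gap between `|A|` and `|B|` is amplified at a cost of a factor `3t` in depth.

Hardness: a power of Lossy-Code has a gap exceeding any constant. It is planted in AMGM-LC between
the two colour classes of a balanced colouring, in Dual-AMGM-LC on the `2M²` monochromatic pairs of
such a colouring, and in Inclusion-Exclusion as the union map of a single full set with `ε = 1/2`.

Membership for AMGM-LC: `t` pigeons give `t` bichromatic pairs, which can be arranged into a word of
length `2t` with any prescribed balanced colour pattern. Pattern and pigeons can be read back from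
the word. Since `C(2t,t) ≥ 4^t/(2t)`, the `C(2t,t)(cN²)^t` codes outnumber the `(2N)^(2t)` words
twice over when `c^t ≥ 4t`. In effect, `(n₀n₁)^t C(2t,t)` is one term of the binomial expansion of
`(n₀+n₁)^(2t)`.

Membership for Dual-AMGM-LC: a word of length `2t+1` is split into `t` monochromatic pairs and one
spare vertex. The pairs are compressed to holes; the colours of the pairs and a label from about
`2^t` values restore the colour pattern (`exists_pairing`). This saves the factor `(2/c)^t` up to a
polynomial in `t`.

Membership for Inclusion-Exclusion: the Bonferroni inequality `∑|S_i| ≤ |⋃S_i| + ∑_{i<j}|S_i ∩ S_j|`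
has an explicit injective proof that looks only at the least index of a set containing a point. It
becomes a retraction with additive gap `εN`, which a polylogarithmic power turns into a factor 2. -/

namespace DecisionTree

/-- Continue at every leaf with a further tree. -/
def bind {Q A B : Type} : DecisionTree Q A → (A → DecisionTree Q B) → DecisionTree Q B
  | leaf a, k => k a
  | query q t₀ t₁, k => query q (bind t₀ k) (bind t₁ k)

theorem eval_bind {Q A B : Type} (t : DecisionTree Q A) (k : A → DecisionTree Q B) (x : Q → Bool) :
    (t.bind k).eval x = (k (t.eval x)).eval x := by
  induction t with
  | leaf a => rfl
  | query q t₀ t₁ h₀ h₁ => cases hq : x q <;> simp [bind, eval, hq, h₀, h₁]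

theorem depth_bind_le {Q A B : Type} (t : DecisionTree Q A) (k : A → DecisionTree Q B) (d : ℕ)
    (hk : ∀ a, (k a).depth ≤ d) : (t.bind k).depth ≤ t.depth + d := by
  induction t with
  | leaf a => simpa [bind, depth] using hk a
  | query q t₀ t₁ h₀ h₁ => simp only [bind, depth]; omega

end DecisionTree

namespace HasDepthLE

variable {Q A B : Type}

theorem mono {h : (Q → Bool) → A} {d e : ℕ} (hh : HasDepthLE h d) (hde : d ≤ e) :
    HasDepthLE h e := by
  obtain ⟨t, ht, hx⟩ := hh
  exact ⟨t, ht.trans hde, hx⟩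

theorem const (a : A) (d : ℕ) : HasDepthLE (fun _ : Q → Bool => a) d :=
  ⟨.leaf a, Nat.zero_le _, fun _ => rfl⟩

theorem bit (q : Q) : HasDepthLE (fun x : Q → Bool => x q) 1 :=
  ⟨.query q (.leaf false) (.leaf true), by simp [DecisionTree.depth], fun x => by
    cases hq : x q <;> simp [DecisionTree.eval, hq]⟩

theorem bind {h : (Q → Bool) → A} {k : A → (Q → Bool) → B} {d e : ℕ} (hh : HasDepthLE h d)
    (hk : ∀ a, HasDepthLE (k a) e) : HasDepthLE (fun x => k (h x) x) (d + e) := by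
  obtain ⟨t, ht, hx⟩ := hh
  choose u hu hux using hk
  refine ⟨t.bind u, (t.depth_bind_le u e hu).trans (by omega), fun x => ?_⟩
  rw [t.eval_bind, hx, hux]

theorem map {h : (Q → Bool) → A} {d : ℕ} (hh : HasDepthLE h d) (φ : A → B) :
    HasDepthLE (fun x => φ (h x)) d :=
  hh.bind (k := fun a _ => φ a) (e := 0) fun _ => const _ _

theorem optionBind {h : (Q → Bool) → Option A} {k : A → (Q → Bool) → Option B} {d e : ℕ}
    (hh : HasDepthLE h d) (hk : ∀ a, HasDepthLE (k a) e) :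
    HasDepthLE (fun x => (h x).bind fun a => k a x) (d + e) := by
  refine hh.bind (k := fun o x => o.bind fun a => k a x) fun o => ?_
  cases o with
  | none => exact const _ _
  | some a => exact hk a

theorem prodMk {h : (Q → Bool) → A} {k : (Q → Bool) → B} {d e : ℕ}
    (hh : HasDepthLE h d) (hk : HasDepthLE k e) : HasDepthLE (fun x => (h x, k x)) (d + e) :=
  hh.bind (k := fun a x => (a, k x)) fun a => hk.map fun b => (a, b)

theorem piFin {n : ℕ} {h : Fin n → (Q → Bool) → A} {d : ℕ} (hh : ∀ i, HasDepthLE (h i) d) :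
    HasDepthLE (fun x i => h i x) (n * d) := by
  induction n with
  | zero =>
    obtain ⟨t, ht, hx⟩ := const (Q := Q) (fun i : Fin 0 => (i.elim0 : A)) 0
    exact ⟨t, by omega, fun x => Subsingleton.elim _ _⟩
  | succ n ih =>
    have := ((hh 0).prodMk (ih fun i => hh i.succ)).map
      fun p => (Fin.cons p.1 p.2 : Fin (n + 1) → A)
    have e : (fun x i => h i x) = fun x => (Fin.cons (h 0 x) fun i => h (Fin.succ i) x :
        Fin (n + 1) → A) := by
      funext x i
      refine Fin.cases ?_ (fun j => ?_) i <;> simp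
    rw [e]
    exact this.mono (by ring_nf; rfl)

theorem pi {ι : Type} [Fintype ι] {h : ι → (Q → Bool) → A} {d : ℕ}
    (hh : ∀ i, HasDepthLE (h i) d) : HasDepthLE (fun x i => h i x) (Fintype.card ι * d) := by
  have := (piFin fun j => hh ((Fintype.equivFin ι).symm j)).map
    fun v i => v (Fintype.equivFin ι i)
  simpa using this

/-- Search for an index that passes a test. -/
theorem exists_select {ι : Type} [Fintype ι] [Nonempty ι] {c : ι → (Q → Bool) → Prop} {d : ℕ}
    (hc : ∀ i, HasDepthLE (c i) d) : ∃ s : (Q → Bool) → ι,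
      HasDepthLE s (Fintype.card ι * d) ∧ ∀ x, (∃ i, c i x) → c (s x) x := by
  classical
  refine ⟨fun x => Classical.epsilon fun i => c i x,
    (pi hc).map fun v => Classical.epsilon fun i => v i, fun x hx => Classical.epsilon_spec hx⟩

/-- Substitute shallow functions for the queried bits. -/
theorem comp {Q' : Type} {h : (Q' → Bool) → A} {φ : Q' → (Q → Bool) → Bool} {d e : ℕ}
    (hh : HasDepthLE h d) (hφ : ∀ q, HasDepthLE (φ q) e) :
    HasDepthLE (fun x => h fun q => φ q x) (d * e) := by
  obtain ⟨t, ht, hx⟩ := hh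
  suffices H : HasDepthLE (fun x => t.eval fun q => φ q x) (t.depth * e) by
    simp only [hx] at H
    exact H.mono (Nat.mul_le_mul_right e ht)
  clear ht hx
  induction t with
  | leaf a => exact const _ _
  | query q t₀ t₁ h₀ h₁ =>
    refine ((hφ q).bind (e := max t₀.depth t₁.depth * e)
      (k := fun b x => bif b then t₁.eval (fun q => φ q x) else t₀.eval fun q => φ q x)
      fun b => ?_).mono ?_
    · cases b
      · exact h₀.mono (Nat.mul_le_mul_right e (le_max_left _ _))
      · exact h₁.mono (Nat.mul_le_mul_right e (le_max_right _ _))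
    · simp only [DecisionTree.depth]
      ring_nf
      rfl

theorem tableEntry {R : Type} {M : ℕ} (emb : TablePos R M → Q) (a : R) :
    HasDepthLE (fun x : Q → Bool => _root_.tableEntry (fun q => x (emb q)) a) (Nat.clog 2 M) := by
  have := (pi fun b : Fin (Nat.clog 2 M) => bit (emb (a, b))).map Nat.ofBits
  simpa [_root_.tableEntry] using this

end HasDepthLE

/-! ### Partial values -/

/-- A number as an element of `[M]`, if it is one. -/
def finOption (M n : ℕ) : Option (Fin M) := if h : n < M then some ⟨n, h⟩ else none

theorem finOption_eq_some {M n : ℕ} {z : Fin M} : finOption M n = some z ↔ n = z := by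
  unfold finOption
  split
  · simp [Fin.ext_iff]
  · simp only [reduceCtorEq, false_iff]
    omega

theorem finOption_coe {M : ℕ} (z : Fin M) : finOption M z = some z := finOption_eq_some.2 rfl

/-- A tuple of partial values as a partial tuple. -/
noncomputable def optionPi {ι A : Type} (v : ι → Option A) : Option (ι → A) :=
  open Classical in if h : ∀ i, (v i).isSome then some fun i => (v i).get (h i) else none

theorem optionPi_eq_some {ι A : Type} {v : ι → Option A} {a : ι → A} :
    optionPi v = some a ↔ ∀ i, v i = some (a i) := by
  unfold optionPi
  split_ifs with h
  · simp [funext_iff, Option.eq_some_iff_get_eq, h]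
  · simp only [false_iff]
    exact fun H => h fun i => by simp [H i]

theorem tableEntry_testBit {A : Type} {M : ℕ} (h : A → ℕ) (a : A) (ha : h a < M) :
    tableEntry (fun q : TablePos A M => (h q.1).testBit q.2) a = h a := by
  simp only [tableEntry, Nat.ofBits_testBit]
  exact Nat.mod_eq_of_lt (ha.trans_le (Nat.le_pow_clog one_lt_two M))

/-! ### Polynomial bounds -/

/-- Boundedness by a polynomial. -/
def PolyBounded (p : ℕ → ℕ) : Prop := ∃ C k : ℕ, ∀ u, p u ≤ C * (u + 1) ^ k

namespace PolyBounded

theorem const (c : ℕ) : PolyBounded fun _ => c := ⟨c, 0, by simp⟩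

theorem id : PolyBounded fun u => u := ⟨1, 1, by simp⟩

theorem add {p q : ℕ → ℕ} (hp : PolyBounded p) (hq : PolyBounded q) :
    PolyBounded fun u => p u + q u := by
  obtain ⟨C, k, hp⟩ := hp
  obtain ⟨D, l, hq⟩ := hq
  refine ⟨C + D, k + l, fun u => ?_⟩
  have h₁ : (u + 1) ^ k ≤ (u + 1) ^ (k + l) := Nat.pow_le_pow_right (by omega) (by omega)
  have h₂ : (u + 1) ^ l ≤ (u + 1) ^ (k + l) := Nat.pow_le_pow_right (by omega) (by omega)
  rw [add_mul]
  exact add_le_add ((hp u).trans (Nat.mul_le_mul_left C h₁))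
    ((hq u).trans (Nat.mul_le_mul_left D h₂))

theorem mul {p q : ℕ → ℕ} (hp : PolyBounded p) (hq : PolyBounded q) :
    PolyBounded fun u => p u * q u := by
  obtain ⟨C, k, hp⟩ := hp
  obtain ⟨D, l, hq⟩ := hq
  refine ⟨C * D, k + l, fun u => (Nat.mul_le_mul (hp u) (hq u)).trans (le_of_eq ?_)⟩
  ring

theorem pow {p : ℕ → ℕ} (hp : PolyBounded p) (n : ℕ) : PolyBounded fun u => p u ^ n := by
  induction n with
  | zero => simpa using const 1
  | succ n ih => simpa only [pow_succ] using ih.mul hp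

end PolyBounded

theorem ReducesWithComplexity.mono {R S : SearchProblem} {b c : ℕ}
    (h : ReducesWithComplexity R S b) (hbc : b ≤ c) : ReducesWithComplexity R S c := by
  obtain ⟨F, d, hF, hd⟩ := h
  exact ⟨F, d, hF, hd.trans hbc⟩

theorem ReducesDT.of_polyBounded {ι κ : Type} {R : ι → SearchProblem} {S : κ → SearchProblem}
    {p : ℕ → ℕ} (hp : PolyBounded p)
    (h : ∀ i, ∃ j, ReducesWithComplexity (R i) (S j) (p (Nat.log 2 (R i).inputLength))) :
    ReducesDT R S := by
  obtain ⟨C, k, hp⟩ := hp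
  refine ⟨C, k, fun i => ?_⟩
  obtain ⟨j, hj⟩ := h i
  exact ⟨j, hj.mono (hp _)⟩

/-- Composition of formulations. -/
def Formulation.trans {R S T : SearchProblem} (F : Formulation R S) (G : Formulation S T) :
    Formulation R T where
  f i x := G.f i fun j => F.f j x
  g o x := F.g (G.g o fun j => F.f j x) x
  correct x o h := F.correct x _ (G.correct _ o h)

/-- Each of the `e` queries of `G` is answered by a tree of depth `d`; the final `d` is for
translating the output of `G` back through `F.g`. -/
theorem Formulation.DepthLE.trans {R S T : SearchProblem} {F : Formulation R S}
    {G : Formulation S T} {d e : ℕ} (hF : F.DepthLE d) (hG : G.DepthLE e) :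
    (F.trans G).DepthLE (e * d + d) :=
  ⟨fun i => ((hG.1 i).comp hF.1).mono (by omega),
    fun o => ((hG.2 o).comp hF.1).bind (k := fun o x => F.g o x) hF.2⟩

theorem ReducesDT.trans {ι κ τ : Type} {R : ι → SearchProblem} {S : κ → SearchProblem}
    {T : τ → SearchProblem} (h₁ : ReducesDT R S) (h₂ : ReducesDT S T) : ReducesDT R T := by
  obtain ⟨C, k, h₁⟩ := h₁
  obtain ⟨D, l, h₂⟩ := h₂
  have hb : PolyBounded fun u => C * (u + 1) ^ k := ⟨C, k, fun u => le_rfl⟩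
  have hc : PolyBounded fun u => D * (C * (u + 1) ^ k + 1) ^ l :=
    (PolyBounded.const D).mul ((hb.add (PolyBounded.const 1)).pow l)
  refine ReducesDT.of_polyBounded ((hc.mul (hb.add (PolyBounded.const 1))).add hb) fun i => ?_
  obtain ⟨j, F, d, hF, hd⟩ := h₁ i
  obtain ⟨m, G, e, hG, he⟩ := h₂ j
  refine ⟨m, F.trans G, _, hF.trans hG, ?_⟩
  set b := C * (Nat.log 2 (R i).inputLength + 1) ^ k
  have hS : D * (Nat.log 2 (S j).inputLength + 1) ^ l ≤ D * (b + 1) ^ l :=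
    Nat.mul_le_mul_left D (Nat.pow_le_pow_left (by omega) l)
  set c := D * (b + 1) ^ l
  have h₁ : e * d ≤ e * b := Nat.mul_le_mul_left e (by omega)
  have h₂ : (Nat.log 2 (T m).inputLength + e) * (b + 1) ≤ c * (b + 1) :=
    Nat.mul_le_mul_right _ (by omega)
  have h₃ : Nat.log 2 (T m).inputLength ≤ Nat.log 2 (T m).inputLength * (b + 1) :=
    Nat.le_mul_of_pos_right _ (by omega)
  nlinarith

/-! ### Logarithms -/

theorem clog_two_le_log_add_one (n : ℕ) : Nat.clog 2 n ≤ Nat.log 2 n + 1 :=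
  Nat.clog_le_of_le_pow (Nat.lt_pow_succ_log_self one_lt_two n).le

theorem clog_two_mul_le (a b : ℕ) : Nat.clog 2 (a * b) ≤ Nat.clog 2 a + Nat.clog 2 b := by
  refine Nat.clog_le_of_le_pow ?_
  rw [pow_add]
  exact Nat.mul_le_mul (Nat.le_pow_clog one_lt_two a) (Nat.le_pow_clog one_lt_two b)

theorem clog_two_pow_le (a t : ℕ) : Nat.clog 2 (a ^ t) ≤ t * Nat.clog 2 a := by
  refine Nat.clog_le_of_le_pow ?_
  rw [mul_comm, pow_mul]
  exact Nat.pow_le_pow_left (Nat.le_pow_clog one_lt_two a) t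

theorem clog_two_add_one_le (n : ℕ) : Nat.clog 2 (n + 1) ≤ Nat.clog 2 n + 1 := by
  refine Nat.clog_le_of_le_pow ?_
  have := Nat.le_pow_clog one_lt_two n
  have := Nat.one_le_two_pow (n := Nat.clog 2 n)
  rw [pow_succ]
  omega

theorem clog_two_mul_two_le (n : ℕ) : Nat.clog 2 (2 * n) ≤ Nat.clog 2 n + 1 := by
  refine Nat.clog_le_of_le_pow ?_
  rw [pow_succ, mul_comm]
  exact Nat.mul_le_mul_right 2 (Nat.le_pow_clog one_lt_two n)

theorem clog_two_le_self (n : ℕ) : Nat.clog 2 n ≤ n :=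
  Nat.clog_le_of_le_pow Nat.lt_two_pow_self.le

/-! ### Retractions with shallow decision trees -/

/-- Partial maps `f : A → B` and `g : B → A` computed by decision trees of depth `d` such that on
every input in `s`, an element `y` with `f (g y) ≠ y` yields a solution of `R`. -/
def HasRetractionOn (R : SearchProblem) (s : Set (R.Pos → Bool)) (A B : Type) (d : ℕ) : Prop :=
  ∃ (f : A → (R.Pos → Bool) → Option B) (g : B → (R.Pos → Bool) → Option A)
    (out : B → (R.Pos → Bool) → R.Out),
    (∀ a, HasDepthLE (f a) d) ∧ (∀ b, HasDepthLE (g b) d) ∧ (∀ b, HasDepthLE (out b) d) ∧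
    ∀ x ∈ s, ∀ y, ((g y x).bind fun a => f a x) ≠ some y → R.Rel x (out y x)

/-- `HasRetractionOn` for all inputs. -/
abbrev HasRetraction (R : SearchProblem) (A B : Type) (d : ℕ) : Prop :=
  HasRetractionOn R Set.univ A B d

namespace HasRetractionOn

variable {R : SearchProblem} {s : Set (R.Pos → Bool)} {A B : Type} {d : ℕ}

/-- Only cardinalities matter: the maps are transported along arbitrary embeddings `A → A'` and `B'
→ B` and left undefined off their images. -/
theorem resize (h : HasRetractionOn R s A B d) {A' B' : Type} [Fintype A] [Fintype B] [Fintype A']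
    [Fintype B'] (hA : Fintype.card A ≤ Fintype.card A') (hB : Fintype.card B' ≤ Fintype.card B) :
    HasRetractionOn R s A' B' d := by
  classical
  obtain ⟨f, g, o, hf, hg, ho, hc⟩ := h
  obtain ⟨i⟩ := Function.Embedding.nonempty_of_card_le hA
  obtain ⟨j⟩ := Function.Embedding.nonempty_of_card_le hB
  refine ⟨fun a' x => (Function.partialInv i a').bind fun a => (f a x).bind (Function.partialInv j),
    fun b' x => (g (j b') x).map i, fun b' => o (j b'), fun a' => ?_, fun b' => (hg _).map _,
    fun b' => ho _, fun x hx y hy => hc x hx _ fun H => hy ?_⟩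
  · dsimp only
    cases Function.partialInv i a' with
    | none => exact HasDepthLE.const _ _
    | some a => exact (hf a).map fun b => b.bind (Function.partialInv j)
  · obtain ⟨a, ha, hfa⟩ := Option.bind_eq_some_iff.1 H
    simp [ha, Function.partialInv_left i.injective, hfa, Function.partialInv_left j.injective]

/-- The amplification step. If a tuple fails to come back, some coordinate does. Testing all
coordinates costs `2td` queries and the output map another `d ≤ td`, whence `3td`. -/
theorem pow (h : HasRetractionOn R s A B d) (t : ℕ) [NeZero t] :
    HasRetractionOn R s (Fin t → A) (Fin t → B) (3 * t * d) := by
  obtain ⟨f, g, o, hf, hg, ho, hc⟩ := h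
  have hchk : ∀ (y : Fin t → B) (i : Fin t),
      HasDepthLE (fun x => ((g (y i) x).bind fun a => f a x) ≠ some (y i)) (d + d) :=
    fun y i => ((hg (y i)).optionBind hf).map fun z => z ≠ some (y i)
  choose sel hsel hspec using fun y => HasDepthLE.exists_select (hchk y)
  refine ⟨fun a x => optionPi fun i => f (a i) x, fun b x => optionPi fun i => g (b i) x,
    fun b x => o (b (sel b x)) x, fun a => ?_, fun b => ?_, fun b => ?_, fun x hx y hy => ?_⟩
  · exact ((HasDepthLE.pi fun i => hf (a i)).map optionPi).mono (by simp; nlinarith)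
  · exact ((HasDepthLE.pi fun i => hg (b i)).map optionPi).mono (by simp; nlinarith)
  · refine ((hsel b).bind (k := fun i => o (b i)) fun i => ho (b i)).mono ?_
    have : d ≤ t * d := Nat.le_mul_of_pos_left d (NeZero.pos t)
    simp only [Fintype.card_fin]
    nlinarith
  · refine hc x hx _ (hspec y x ?_)
    by_contra! H
    refine hy (Option.bind_eq_some_iff.2 ?_)
    choose a ha hfa using fun i => Option.bind_eq_some_iff.1 (H i)
    exact ⟨a, optionPi_eq_some.2 ha, optionPi_eq_some.2 hfa⟩

/-- Padding by a common summand makes sizes independent of the input while keeping their difference.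
Elements of `D` always return, so their output is arbitrary. -/
theorem sum_id (h : HasRetractionOn R s A B d) [Nonempty R.Out] (D : Type) :
    HasRetractionOn R s (A ⊕ D) (B ⊕ D) d := by
  obtain ⟨f, g, o, hf, hg, ho, hc⟩ := h
  refine ⟨Sum.elim (fun a x => (f a x).map .inl) fun e _ => some (.inr e),
    Sum.elim (fun b x => (g b x).map .inl) fun e _ => some (.inr e),
    Sum.elim o fun _ _ => Classical.arbitrary _, ?_, ?_, ?_, fun x hx y hy => ?_⟩
  · exact Sum.rec (fun a => (hf a).map (Option.map Sum.inl)) fun e => HasDepthLE.const _ _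
  · exact Sum.rec (fun a => (hg a).map (Option.map Sum.inl)) fun e => HasDepthLE.const _ _
  · exact Sum.rec (fun a => ho a) fun e => HasDepthLE.const _ _
  · cases y with
    | inr e => simp at hy
    | inl y =>
      refine hc x hx y fun H => hy ?_
      obtain ⟨a, ha, hfa⟩ := Option.bind_eq_some_iff.1 H
      simp [ha, hfa]

theorem prod_id (h : HasRetractionOn R s A B d) (D : Type) :
    HasRetractionOn R s (D × A) (D × B) d := by
  obtain ⟨f, g, o, hf, hg, ho, hc⟩ := h
  refine ⟨fun a x => (f a.2 x).map (Prod.mk a.1), fun b x => (g b.2 x).map (Prod.mk b.1),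
    fun b => o b.2, fun a => (hf _).map _, fun b => (hg _).map _, fun b => ho _,
    fun x hx y hy => hc x hx y.2 fun H => hy ?_⟩
  obtain ⟨a, ha, hfa⟩ := Option.bind_eq_some_iff.1 H
  simp [ha, hfa]

/-- Use different maps depending on a shallow function of the input. -/
theorem of_fibers {Θ : Type} {θ : (R.Pos → Bool) → Θ} {e : ℕ} (hθ : HasDepthLE θ e)
    (h : ∀ c, HasRetractionOn R {x | θ x = c} A B d) : HasRetraction R A B (e + d) := by
  choose f g o hf hg ho hc using h
  exact ⟨fun a x => f (θ x) a x, fun b x => g (θ x) b x, fun b x => o (θ x) b x,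
    fun a => hθ.bind (k := fun c => f c a) fun c => hf c a,
    fun a => hθ.bind (k := fun c => g c a) fun c => hg c a,
    fun a => hθ.bind (k := fun c => o c a) fun c => ho c a, fun x _ y hy => hc (θ x) x rfl y hy⟩

theorem total [Fintype A] [Fintype B] (h : HasRetraction R A B d)
    (hcard : Fintype.card A < Fintype.card B) : R.Total := by
  intro x
  by_contra! H
  obtain ⟨f, g, o, -, -, -, hc⟩ := h
  have hc' : ∀ y, ∃ a, g y x = some a ∧ f a x = some y := fun y =>
    Option.bind_eq_some_iff.1 (by_contra fun hy => H _ (hc x trivial y hy))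
  choose i hi hfi using hc'
  refine hcard.not_ge (Fintype.card_le_of_injective i fun y z hyz => ?_)
  have := hfi y
  rw [hyz, hfi z] at this
  exact (Option.some.inj this).symm

end HasRetractionOn

/-! ### Retractions and Lossy-Code -/

theorem hasRetraction_lossyCode (N : ℕ+) :
    HasRetraction (lossyCode N) (Fin N) (Fin (2 * N)) (Nat.clog 2 (2 * N)) := by
  refine ⟨fun a x => finOption _ (LossyCode.f x a), fun b x => finOption _ (LossyCode.g x b),
    fun b _ => b, fun a => ?_, fun b => ?_, fun b => HasDepthLE.const _ _, fun x _ y hy => ?_⟩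
  · exact (HasDepthLE.tableEntry Sum.inl a).map _
  · exact ((HasDepthLE.tableEntry Sum.inr b).map _).mono (Nat.clog_mono_right 2 (by omega))
  · rintro ⟨z, hz, hf⟩
    refine hy (Option.bind_eq_some_iff.2 ⟨z, finOption_eq_some.2 hz, finOption_eq_some.2 hf⟩)

theorem inputLength_lossyCode (N : ℕ+) :
    (lossyCode N).inputLength = N * Nat.clog 2 (2 * N) + 2 * N * Nat.clog 2 N := by
  change Fintype.card (LossyCode.Pos N) = _
  simp

theorem le_inputLength_lossyCode (N : ℕ+) : (N : ℕ) ≤ (lossyCode N).inputLength := by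
  rw [inputLength_lossyCode]
  have : 0 < Nat.clog 2 (2 * N) := Nat.clog_pos one_lt_two (by have := N.pos; omega)
  nlinarith

theorem HasRetractionOn.reduces_lossyCode {R : SearchProblem} {N : ℕ+} {d : ℕ}
    (h : HasRetraction R (Fin N) (Fin (2 * N)) d) :
    ReducesWithComplexity R (lossyCode N) (2 * Nat.clog 2 N + 3 + d) := by
  obtain ⟨f, g, o, hf, hg, ho, hc⟩ := h
  let F : Formulation R (lossyCode N) :=
    { f := Sum.elim
        -- An undefined value is stored as 0. This is harmless: correctness only needs that a
        -- genuine equality `f (g y) = y`, in which both values are defined, is stored faithfully.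
        (fun q x => (((f q.1 x).map Fin.val).getD 0).testBit q.2)
        fun q x => (((g q.1 x).map Fin.val).getD 0).testBit q.2
      g := o
      correct := fun x y hy => by
        refine hc x trivial y fun H => hy ?_
        obtain ⟨a, ha, hfa⟩ := Option.bind_eq_some_iff.1 H
        refine ⟨a, ?_, ?_⟩
        · refine (tableEntry_testBit (fun b => ((g b x).map Fin.val).getD 0) y ?_).trans ?_ <;>
            simp [ha]
        · refine (tableEntry_testBit (fun b => ((f b x).map Fin.val).getD 0) a ?_).trans ?_
          · rw [hfa]
            exact Fin.is_lt y
          · rw [hfa]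
            rfl }
  refine ⟨F, d, ⟨Sum.rec (fun q => (hf q.1).map fun b => ((b.map Fin.val).getD 0).testBit q.2)
    fun q => (hg q.1).map fun b => ((b.map Fin.val).getD 0).testBit q.2, ho⟩, ?_⟩
  have h₁ : (lossyCode N).inputLength ≤ 2 ^ 3 * (N * N) := by
    rw [inputLength_lossyCode]
    have := clog_two_le_self (2 * N)
    have := clog_two_le_self N
    nlinarith
  have h₂ := (Nat.log_le_clog 2 _).trans (Nat.clog_mono_right 2 h₁)
  have h₃ := clog_two_mul_le (2 ^ 3) (N * N)
  have h₄ := clog_two_mul_le N N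
  have h₅ := Nat.clog_le_of_le_pow (le_refl (2 ^ 3))
  omega

theorem inLossy_of_hasRetraction {ι : Type} {R : ι → SearchProblem} {p : ℕ → ℕ}
    (hp : PolyBounded p) (h : ∀ i, ∃ (A B : Type) (_ : Fintype A) (_ : Fintype B) (d : ℕ),
      HasRetraction (R i) A B d ∧ 2 * Fintype.card A ≤ Fintype.card B ∧ 2 ≤ Fintype.card B ∧
      Nat.clog 2 (Fintype.card B) + d ≤ p (Nat.log 2 (R i).inputLength)) : InLossy R := by
  refine ⟨fun i => ?_, ReducesDT.of_polyBounded
    (((PolyBounded.const 2).mul hp).add (PolyBounded.const 3)) fun i => ?_⟩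
  · obtain ⟨A, B, _, _, d, hr, h₁, h₂, -⟩ := h i
    exact hr.total (by omega)
  · obtain ⟨A, B, _, _, d, hr, h₁, h₂, h₃⟩ := h i
    -- Lossy-Code needs `N ≥ 1`; if `A` is empty, the hypothesis `2 ≤ |B|` takes over.
    let N : ℕ+ := ⟨max (Fintype.card A) 1, by positivity⟩
    have hN : (N : ℕ) = max (Fintype.card A) 1 := rfl
    have hr' : HasRetraction (R i) (Fin N) (Fin (2 * N)) d :=
      hr.resize (by simp [hN]) (by rw [Fintype.card_fin, hN]; omega)
    refine ⟨N, hr'.reduces_lossyCode.mono ?_⟩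
    have : Nat.clog 2 N ≤ Nat.clog 2 (Fintype.card B) := Nat.clog_mono_right 2 (by omega)
    omega

theorem lossyComplete_of_reduces {ι : Type} {R : ι → SearchProblem} (h : InLossy R)
    (h' : ReducesDT lossyCode R) : LossyComplete R :=
  ⟨h, fun _ _ hS => hS.2.trans h'⟩

/-! ### Hardness -/

theorem card_coloringPos (N K : ℕ) : Fintype.card (ColoringPos N K) =
    2 * N + (K * Nat.clog 2 (2 * N) + (K * Nat.clog 2 (2 * N) + 2 * N * (2 * N) * Nat.clog 2 K)) := by
  rw [Fintype.card_congr (ColoringPos.proxyTypeEquiv N K).symm]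
  simp

theorem clog_card_coloringPos_le (N K : ℕ) :
    Nat.clog 2 (Fintype.card (ColoringPos N K)) ≤ 4 + 2 * Nat.clog 2 N + Nat.clog 2 (K + 1) := by
  have h₁ : Fintype.card (ColoringPos N K) ≤ 2 ^ 4 * (N * N * (K + 1)) := by
    rw [card_coloringPos]
    have h₁ := Nat.mul_le_mul_left K (clog_two_le_self (2 * N))
    have h₂ := Nat.mul_le_mul_left (2 * N * (2 * N)) (clog_two_le_self K)
    have h₃ : N ≤ N * N := Nat.le_mul_self N
    have h₄ := Nat.mul_le_mul_left K h₃
    nlinarith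
  have h₂ := clog_two_mul_le (2 ^ 4) (N * N * (K + 1))
  have h₃ := clog_two_mul_le (N * N) (K + 1)
  have h₄ := clog_two_mul_le N N
  have h₅ := Nat.clog_le_of_le_pow (le_refl (2 ^ 4))
  have h₆ := Nat.clog_mono_right 2 h₁
  omega

theorem inputLength_amgmLC (c : ℝ) (N : ℕ+) : (amgmLC c N).inputLength =
    Fintype.card (ColoringPos N ⌈c * (N : ℝ) ^ 2⌉₊) := rfl

theorem inputLength_dualAmgmLC (c : ℝ) (N : ℕ+) : (dualAmgmLC c N).inputLength =
    Fintype.card (ColoringPos N ⌊c * (N : ℝ) ^ 2⌋₊) := rfl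

/-- With the lower half of `[2M]` coloured 0 and the upper half 1, the bichromatic pairs are a copy
of `[M] × [M]`. The map `F` on pigeons is the retraction's `g`, and `G` is its `f`. -/
theorem HasRetractionOn.reduces_amgmLC {R : SearchProblem} {c : ℝ} {M : ℕ+} {d : ℕ}
    (h : HasRetraction R (Fin M × Fin M) (Fin ⌈c * (M : ℝ) ^ 2⌉₊) d) :
    ReducesWithComplexity R (amgmLC c M)
      (Nat.clog 2 (Fintype.card (ColoringPos M ⌈c * (M : ℝ) ^ 2⌉₊)) + d) := by
  obtain ⟨f, g, o, hf, hg, ho, hc⟩ := h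
  let G : Fin (2 * M) × Fin (2 * M) → (R.Pos → Bool) → Option (Fin ⌈c * (M : ℝ) ^ 2⌉₊) := fun w x =>
    (finOption M w.1).bind fun u => (finOption M (w.2 - M)).bind fun v => f (u, v) x
  have hG : ∀ w, HasDepthLE (G w) d := fun w => by
    simp only [G]
    cases finOption M w.1 with
    | none => exact HasDepthLE.const _ _
    | some u =>
      cases finOption M (w.2 - M) with
      | none => exact HasDepthLE.const _ _
      | some v => exact hf _
  let F : Formulation R (amgmLC c M) :=
    { f := fun q x => match q with
        | .color v => decide ((M : ℕ) ≤ v)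
        | .fst p => (((g p.1 x).map fun w => (w.1 : ℕ)).getD 0).testBit p.2
        | .snd p => (((g p.1 x).map fun w => (w.2 : ℕ) + M).getD 0).testBit p.2
        | .back p => (((G p.1 x).map Fin.val).getD 0).testBit p.2
      g := o
      correct := fun x y hy => by
        refine hc x trivial y fun H => hy ?_
        obtain ⟨⟨u, v⟩, ha, hfa⟩ := Option.bind_eq_some_iff.1 H
        have hu := u.2
        have hv := v.2
        refine ⟨⟨u, by omega⟩, ⟨v + M, by omega⟩, Prod.ext ?_ ?_, ⟨?_, ?_⟩, ?_⟩
        · refine (tableEntry_testBit (fun b => ((g b x).map fun w => (w.1 : ℕ)).getD 0) y ?_).trans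
            ?_ <;> simp only [ha, Option.map_some, Option.getD_some]
          omega
        · refine (tableEntry_testBit
            (fun b => ((g b x).map fun w => (w.2 : ℕ) + M).getD 0) y ?_).trans
            ?_ <;> simp only [ha, Option.map_some, Option.getD_some]
          omega
        · simp [ColoringPos.C]
        · simp [ColoringPos.C]
        · have hGa : G (⟨u, by omega⟩, ⟨v + M, by omega⟩) x = some y := by
            simp only [G, Nat.add_sub_cancel, finOption_coe, Option.bind_some]
            exact hfa
          refine (tableEntry_testBit (fun b => ((G b x).map Fin.val).getD 0) _ ?_).trans ?_ <;>
            rw [hGa]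
          · exact Fin.is_lt y
          · rfl }
  refine ⟨F, d, ⟨fun q => ?_, ho⟩, ?_⟩
  · match q with
    | .color v => exact HasDepthLE.const _ _
    | .fst p => exact (hg p.1).map fun b => ((b.map fun w => (w.1 : ℕ)).getD 0).testBit p.2
    | .snd p => exact (hg p.1).map fun b => ((b.map fun w => (w.2 : ℕ) + M).getD 0).testBit p.2
    | .back p => exact (hG p.1).map fun b => ((b.map Fin.val).getD 0).testBit p.2
  · rw [inputLength_amgmLC]
    exact Nat.add_le_add_right (Nat.log_le_clog _ _) _

/-- The half of `[2M]` that contains `v`, and the position of `v` in it. -/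
def splitHalf {M : ℕ} (v : Fin (2 * M)) : Bool × Fin M :=
  if hv : (v : ℕ) < M then (false, ⟨v, hv⟩) else (true, ⟨v - M, by omega⟩)

/-- The element of `[2M]` with the given half and position. -/
def joinHalf {M : ℕ} (b : Bool) (u : Fin M) : ℕ := u + if b then M else 0

theorem joinHalf_splitHalf {M : ℕ} (v : Fin (2 * M)) :
    joinHalf (splitHalf v).1 (splitHalf v).2 = v := by
  unfold joinHalf splitHalf
  by_cases h : (v : ℕ) < M
  · simp [h]
  · simp only [h, dite_false, if_true]
    omega

/-- With the two halves as colour classes, a monochromatic pair is a half together with two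
positions in it. On other pairs `pair` forgets the half of the second vertex, but these are never
solutions. -/
theorem HasRetractionOn.reduces_dualAmgmLC {R : SearchProblem} {c : ℝ} {M : ℕ+} {d : ℕ}
    (h : HasRetraction R (Fin ⌊c * (M : ℝ) ^ 2⌋₊) (Bool × Fin M × Fin M) d) :
    ReducesWithComplexity R (dualAmgmLC c M)
      (Nat.clog 2 (Fintype.card (ColoringPos M ⌊c * (M : ℝ) ^ 2⌋₊)) + d) := by
  obtain ⟨f, g, o, hf, hg, ho, hc⟩ := h
  let pair : Fin (2 * M) × Fin (2 * M) → Bool × Fin M × Fin M :=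
    fun w => ((splitHalf w.1).1, (splitHalf w.1).2, (splitHalf w.2).2)
  let fst : Option (Bool × Fin M × Fin M) → ℕ := fun w => (w.map fun w => joinHalf w.1 w.2.1).getD 0
  let snd : Option (Bool × Fin M × Fin M) → ℕ := fun w => (w.map fun w => joinHalf w.1 w.2.2).getD 0
  let F : Formulation R (dualAmgmLC c M) :=
    { f := fun q x => match q with
        | .color v => (splitHalf v).1
        | .fst p => (fst (f p.1 x)).testBit p.2
        | .snd p => (snd (f p.1 x)).testBit p.2
        | .back p => (((g (pair p.1) x).map Fin.val).getD 0).testBit p.2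
      g := fun w => o (pair w)
      correct := fun x w hw => by
        obtain ⟨u, v⟩ := w
        obtain ⟨hC, hw⟩ := hw
        refine hc x trivial (pair (u, v)) fun H => hw ?_
        obtain ⟨a, ha, hfa⟩ := Option.bind_eq_some_iff.1 H
        have hC' : (splitHalf u).1 = (splitHalf v).1 := hC
        have e₁ : fst (f a x) = u := by
          rw [hfa]
          exact joinHalf_splitHalf u
        have e₂ : snd (f a x) = v := by
          rw [hfa]
          refine Eq.trans ?_ (joinHalf_splitHalf v)
          rw [← hC']
          rfl
        refine ⟨a, ?_, Prod.ext ?_ ?_⟩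
        · refine (tableEntry_testBit (fun b => ((g (pair b) x).map Fin.val).getD 0) _ ?_).trans ?_
            <;> rw [ha]
          · exact Fin.is_lt a
          · rfl
        · exact (tableEntry_testBit (fun b => fst (f b x)) a (e₁.trans_lt u.2)).trans e₁
        · exact (tableEntry_testBit (fun b => snd (f b x)) a (e₂.trans_lt v.2)).trans e₂ }
  refine ⟨F, d, ⟨fun q => ?_, fun w => ho _⟩, ?_⟩
  · match q with
    | .color v => exact HasDepthLE.const _ _
    | .fst p => exact (hf p.1).map fun b => (fst b).testBit p.2
    | .snd p => exact (hf p.1).map fun b => (snd b).testBit p.2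
    | .back p => exact (hg _).map fun b => ((b.map Fin.val).getD 0).testBit p.2
  · rw [inputLength_dualAmgmLC]
    exact Nat.add_le_add_right (Nat.log_le_clog _ _) _

/-! ### Planting powers of Lossy-Code in the colouring problems -/

theorem clog_le_log_inputLength_lossyCode (N : ℕ+) :
    Nat.clog 2 N ≤ Nat.log 2 (lossyCode N).inputLength + 1 :=
  (clog_two_le_log_add_one _).trans
    (Nat.add_le_add_right (Nat.log_mono_right (le_inputLength_lossyCode N)) 1)

theorem reducesDT_lossyCode_amgmLC (c : ℝ) : ReducesDT lossyCode (amgmLC c) := by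
  obtain ⟨s, hs⟩ := pow_unbounded_of_one_lt c (by norm_num : (1 : ℝ) < 4)
  have hs' : c ≤ 4 ^ (s + 1) := hs.le.trans (pow_le_pow_right₀ (by norm_num) (by omega))
  clear hs
  have hpoly : PolyBounded fun u => 4 + 2 * ((s + 1) * (u + 1)) + (2 * (s + 1) * (u + 2) + 1)
      + 3 * (2 * (s + 1)) * (u + 2) := by
    have h := fun c => PolyBounded.id.add (PolyBounded.const c)
    have k := PolyBounded.const
    exact (((k 4).add ((k 2).mul ((k (s + 1)).mul (h 1)))).add (((k _).mul (h 2)).add (k 1))).add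
      ((k _).mul (h 2))
  refine ReducesDT.of_polyBounded hpoly fun N => ?_
  set u := Nat.log 2 (lossyCode N).inputLength
  have hu : Nat.clog 2 N ≤ u + 1 := clog_le_log_inputLength_lossyCode N
  have hu' : Nat.clog 2 (2 * N) ≤ u + 2 := by
    have := clog_two_mul_two_le N
    omega
  -- The power `2(s+1)` of Lossy-Code goes from `N^(2(s+1)) = M²` to `4^(s+1) M² ≥ cM²` elements.
  -- Using `s + 1` instead of `s` keeps the exponent positive.
  let M : ℕ+ := N ^ (s + 1)
  have hM : (M : ℕ) = (N : ℕ) ^ (s + 1) := by simp [M]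
  have hK : ⌈c * ((M : ℕ) : ℝ) ^ 2⌉₊ ≤ (2 * (N : ℕ)) ^ (2 * (s + 1)) := by
    refine Nat.ceil_le.2 ?_
    rw [hM]
    push_cast
    rw [mul_pow, pow_mul, pow_mul' _ 2 (s + 1), show (2 : ℝ) ^ 2 = 4 by norm_num]
    exact mul_le_mul_of_nonneg_right hs' (by positivity)
  have hr := (hasRetraction_lossyCode N).pow (2 * (s + 1))
  have hr' : HasRetraction (lossyCode N) (Fin M × Fin M) (Fin ⌈c * ((M : ℕ) : ℝ) ^ 2⌉₊)
      (3 * (2 * (s + 1)) * Nat.clog 2 (2 * N)) := by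
    refine hr.resize ?_ ?_
    · simp only [Fintype.card_fun, Fintype.card_fin, Fintype.card_prod, hM]
      exact le_of_eq (by ring)
    · simpa using hK
  refine ⟨M, hr'.reduces_amgmLC.mono ?_⟩
  have h₁ := clog_card_coloringPos_le M ⌈c * ((M : ℕ) : ℝ) ^ 2⌉₊
  have h₂ : Nat.clog 2 M ≤ (s + 1) * (u + 1) := by
    rw [hM]
    exact (clog_two_pow_le _ _).trans (Nat.mul_le_mul_left _ hu)
  have h₃ : Nat.clog 2 (⌈c * ((M : ℕ) : ℝ) ^ 2⌉₊ + 1) ≤ 2 * (s + 1) * (u + 2) + 1 := by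
    refine (clog_two_add_one_le _).trans (Nat.add_le_add_right ?_ 1)
    exact (Nat.clog_mono_right 2 hK).trans ((clog_two_pow_le _ _).trans (Nat.mul_le_mul_left _ hu'))
  have h₄ := Nat.mul_le_mul_left (3 * (2 * (s + 1))) hu'
  omega

theorem reducesDT_lossyCode_dualAmgmLC {c : ℝ} (hc : 0 < c) (hc₂ : c < 2) :
    ReducesDT lossyCode (dualAmgmLC c) := by
  obtain ⟨s, hs⟩ := pow_unbounded_of_one_lt (2 / c) (by norm_num : (1 : ℝ) < 4)
  have hs' : 2 ≤ c * 4 ^ (s + 1) := by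
    have h₁ : 2 / c ≤ 4 ^ (s + 1) := hs.le.trans (pow_le_pow_right₀ (by norm_num) (by omega))
    rw [div_le_iff₀ hc] at h₁
    linarith
  clear hs
  have hpoly : PolyBounded fun u => 4 + 2 * ((s + 1) * (u + 2)) + (2 * (s + 1) * (u + 2) + 2)
      + 3 * (2 * (s + 1)) * (u + 2) := by
    have h := fun c => PolyBounded.id.add (PolyBounded.const c)
    have k := PolyBounded.const
    exact (((k 4).add ((k 2).mul ((k (s + 1)).mul (h 2)))).add (((k _).mul (h 2)).add (k 2))).add
      ((k _).mul (h 2))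
  refine ReducesDT.of_polyBounded hpoly fun N => ?_
  set u := Nat.log 2 (lossyCode N).inputLength
  have hu : Nat.clog 2 N ≤ u + 1 := clog_le_log_inputLength_lossyCode N
  have hu' : Nat.clog 2 (2 * N) ≤ u + 2 := by
    have := clog_two_mul_two_le N
    omega
  -- Here the large side `(2N)^(2(s+1)) = M²` matches pairs of positions, and the factor `Bool`
  -- chooses the half. The small side `2N^(2(s+1))` fits into the holes since `2 ≤ c · 4^(s+1)`.
  let M : ℕ+ := (2 * N) ^ (s + 1)
  have hM : (M : ℕ) = (2 * (N : ℕ)) ^ (s + 1) := by simp [M]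
  have hK : 2 * (N : ℕ) ^ (2 * (s + 1)) ≤ ⌊c * ((M : ℕ) : ℝ) ^ 2⌋₊ := by
    refine Nat.le_floor ?_
    rw [hM]
    push_cast
    rw [mul_pow, mul_pow, ← pow_mul, ← pow_mul, mul_comm (s + 1) 2, pow_mul 2 2,
      show (2 : ℝ) ^ 2 = 4 by norm_num, ← mul_assoc]
    exact mul_le_mul_of_nonneg_right hs' (by positivity)
  have hK' : ⌊c * ((M : ℕ) : ℝ) ^ 2⌋₊ ≤ 2 * (M : ℕ) ^ 2 := by
    refine Nat.floor_le_of_le ?_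
    push_cast
    exact mul_le_mul_of_nonneg_right hc₂.le (by positivity)
  have hr := ((hasRetraction_lossyCode N).pow (2 * (s + 1))).prod_id Bool
  have hr' : HasRetraction (lossyCode N) (Fin ⌊c * ((M : ℕ) : ℝ) ^ 2⌋₊) (Bool × Fin M × Fin M)
      (3 * (2 * (s + 1)) * Nat.clog 2 (2 * N)) := by
    refine hr.resize ?_ ?_
    · simpa using hK
    · simp only [Fintype.card_fun, Fintype.card_fin, Fintype.card_prod, hM]
      exact le_of_eq (by ring)
  refine ⟨M, hr'.reduces_dualAmgmLC.mono ?_⟩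
  have h₁ := clog_card_coloringPos_le M ⌊c * ((M : ℕ) : ℝ) ^ 2⌋₊
  have h₂ : Nat.clog 2 M ≤ (s + 1) * (u + 2) := by
    rw [hM]
    exact (clog_two_pow_le _ _).trans (Nat.mul_le_mul_left _ hu')
  have h₃ : Nat.clog 2 (⌊c * ((M : ℕ) : ℝ) ^ 2⌋₊ + 1) ≤ 2 * (s + 1) * (u + 2) + 2 := by
    refine (clog_two_add_one_le _).trans (Nat.add_le_add_right ?_ 1)
    refine (Nat.clog_mono_right 2 hK').trans ((clog_two_mul_two_le _).trans ?_)
    refine Nat.add_le_add_right ((clog_two_pow_le _ _).trans ?_) 1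
    rw [mul_assoc]
    exact Nat.mul_le_mul_left 2 h₂
  have h₄ := Nat.mul_le_mul_left (3 * (2 * (s + 1))) hu'
  omega

/-! ### Hardness of Inclusion-Exclusion: a single full set -/

theorem isEmpty_indexPair_one : IsEmpty (IndexPair 1) := ⟨fun p => by have := p.2; omega⟩

theorem card_inclExclPos_one (N : ℕ) : Fintype.card (InclExclPos N 1) =
    N + (Nat.clog 2 (N + 1) + 4 * (N * Nat.clog 2 N)) := by
  rw [Fintype.card_congr (InclExclPos.proxyTypeEquiv N 1).symm]
  have := isEmpty_indexPair_one
  simp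
  ring

theorem le_card_inclExclPos {N l : ℕ} (hl : 0 < l) : N ≤ Fintype.card (InclExclPos N l) := by
  have := Fintype.card_le_of_injective (fun y : Fin N => (InclExclPos.mem ⟨0, hl⟩ y : InclExclPos N l))
    fun y z h => by simpa using h
  simpa using this

theorem inputLength_inclusionExclusion (C k : ℕ) (P : InclExclParam C k) :
    (inclusionExclusion C k P).inputLength = Fintype.card (InclExclPos P.N P.l) := rfl

/-- The parameters of an instance with a single set and `ε = 1 / 2`. -/
noncomputable def InclExclParam.single {C k : ℕ} (hC : 1 ≤ C) (hk : 1 ≤ k) (N : ℕ) (hN : 8 ≤ N) :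
    InclExclParam C k :=
  -- `N ≥ 8` gives `log₂ N ≥ 3`, enough for `ε = 1/2` to satisfy the strict bound, as `3/2 > 1`.
  have h : (3 : ℝ) ≤ C * Real.logb 2 N ^ k := by
    have h₁ : (3 : ℝ) ≤ Real.logb 2 N := by
      rw [Real.le_logb_iff_rpow_le one_lt_two (by positivity)]
      norm_num
      exact_mod_cast hN
    have h₂ : Real.logb 2 N ≤ Real.logb 2 N ^ k := le_self_pow₀ (by linarith) (by omega)
    have h₃ : (1 : ℝ) ≤ C := by exact_mod_cast hC
    nlinarith
  { N := N
    l := 1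
    ε := 1 / 2
    l_le := by norm_num; linarith
    lt_ε := by linarith }

/-- The input with the single set `[N]`, its cardinality `N` certified by the identity, and the
given maps on the union. -/
def InclExclPos.singleBits {N : ℕ} (fN : Fin (1 * N) → ℕ) (gN : Fin N → ℕ) : InclExclPos N 1 → Bool
  | .mem _ _ => true
  | .card p => N.testBit p.2
  | .cardInter _ => false
  | .single p => (p.1.2 : ℕ).testBit p.2
  | .singleBack p => (p.1.2 : ℕ).testBit p.2
  | .inter _ => false
  | .interBack _ => false
  | .union p => (fN p.1).testBit p.2
  | .unionBack p => (gN p.1).testBit p.2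

theorem InclExclParam.rel_single {C k : ℕ} (hC : 1 ≤ C) (hk : 1 ≤ k) {N : ℕ} (hN : 8 ≤ N)
    {fN : Fin (1 * N) → ℕ} {gN : Fin N → ℕ}
    {w : (inclusionExclusion C k (.single hC hk N hN)).Out}
    (hw : (inclusionExclusion C k (.single hC hk N hN)).Rel (InclExclPos.singleBits fN gN) w) :
    ∃ y : Fin N, w = .inr (.inr y) ∧
      ¬ ∃ z : Fin (1 * N), 2 * (z + 1 : ℕ) ≤ N ∧ gN y = z ∧ fN z = y := by
  have ha : ∀ i, InclExclPos.a (InclExclPos.singleBits fN gN) i = N := fun i =>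
    tableEntry_testBit (fun _ => N) i (Nat.lt_succ_self N)
  have hempty := isEmpty_indexPair_one
  have haT : InclExclPos.aTilde (InclExclPos.singleBits fN gN) = N := by
    simp [InclExclPos.aTilde, ha]
  have hv : InclExclPos.Valid (InclExclPos.singleBits fN gN) (1 / 2) := by
    refine ⟨fun i => (ha i).le, fun p => hempty.elim p, ?_⟩
    rw [haT]
    push_cast
    linarith [(Nat.cast_nonneg N : (0 : ℝ) ≤ N)]
  have hw := hw hv
  match w with
  | .inl (i, y) =>
    refine (hw.2 ⟨y, ?_, rfl, ?_⟩).elim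
    · exact tableEntry_testBit (M := N) (fun q : Fin 1 × Fin N => (q.2 : ℕ)) (i, y) (Fin.is_lt y)
    · exact tableEntry_testBit (M := N) (fun q : Fin 1 × Fin N => (q.2 : ℕ)) (i, y) (Fin.is_lt y)
  | .inr (.inl (p, y)) => exact hempty.elim p
  | .inr (.inr y) =>
    refine ⟨y, rfl, fun ⟨z, hz, hg, hf⟩ => hw.2 ⟨z, ?_, ?_, ?_⟩⟩
    -- With `ã = N` and `ε = 1/2` the permitted rows are `z < ⌊N/2⌋`, that is, `2(z+1) ≤ N`.
    · change (z : ℕ) < ⌊((InclExclPos.aTilde (InclExclPos.singleBits fN gN) : ℤ) : ℝ)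
        - 1 / 2 * (N : ℝ)⌋₊
      rw [haT]
      refine Nat.le_floor ?_
      have : ((2 * (z + 1) : ℕ) : ℝ) ≤ N := by exact_mod_cast hz
      push_cast at this ⊢
      linarith
    · exact (tableEntry_testBit (M := 1 * N) gN y (hg.trans_lt z.2)).trans hg
    · exact (tableEntry_testBit (M := N) fN z (hf.trans_lt (Fin.is_lt y))).trans hf

theorem HasRetractionOn.reduces_inclusionExclusion {R : SearchProblem} {C k : ℕ} (hC : 1 ≤ C)
    (hk : 1 ≤ k) {N L : ℕ} (hN : 8 ≤ N) (hL : 2 * L ≤ N) {d : ℕ}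
    (h : HasRetraction R (Fin L) (Fin N) d) :
    ReducesWithComplexity R (inclusionExclusion C k (.single hC hk N hN))
      (3 + 2 * Nat.clog 2 N + d) := by
  obtain ⟨f, g, o, hf, hg, ho, hc⟩ := h
  let fN : Fin (1 * N) → (R.Pos → Bool) → ℕ := fun z x =>
    (((finOption L z).bind fun z => f z x).map Fin.val).getD 0
  have hfN : ∀ z, HasDepthLE (fN z) d := fun z => by
    simp only [fN]
    cases finOption L z with
    | none => exact HasDepthLE.const _ _
    | some z => exact (hf z).map fun b => (b.map Fin.val).getD 0
  let gN : Fin N → (R.Pos → Bool) → ℕ := fun y x => ((g y x).map Fin.val).getD 0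
  let F : Formulation R (inclusionExclusion C k (.single hC hk N hN)) :=
    { f := fun q x => InclExclPos.singleBits (fun z => fN z x) (fun y => gN y x) q
      g := fun w => match w with
        | .inl w => o w.2
        | .inr (.inl w) => o w.2
        | .inr (.inr y) => o y
      correct := fun x w hw => by
        obtain ⟨y, rfl, hy⟩ := InclExclParam.rel_single hC hk hN hw
        refine hc x trivial y fun H => hy ?_
        obtain ⟨a, ha, hfa⟩ := Option.bind_eq_some_iff.1 H
        refine ⟨⟨a, by have := a.2; omega⟩, ?_, ?_, ?_⟩
        · have := a.2
          dsimp only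
          omega
        · simp only [gN, ha, Option.map_some, Option.getD_some]
        · simp only [fN, finOption_coe, Option.bind_some, hfa, Option.map_some, Option.getD_some] }
  refine ⟨F, d, ⟨fun q => ?_, fun w => ?_⟩, ?_⟩
  · match q with
    | .mem _ _ => exact HasDepthLE.const _ _
    | .card p => exact HasDepthLE.const _ _
    | .cardInter _ => exact HasDepthLE.const _ _
    | .single p => exact HasDepthLE.const _ _
    | .singleBack p => exact HasDepthLE.const _ _
    | .inter _ => exact HasDepthLE.const _ _
    | .interBack _ => exact HasDepthLE.const _ _
    | .union p => exact (hfN p.1).map fun b => b.testBit p.2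
    | .unionBack p => exact (hg p.1).map fun b => ((b.map Fin.val).getD 0).testBit p.2
  · match w with
    | .inl w => exact ho w.2
    | .inr (.inl w) => exact ho w.2
    | .inr (.inr y) => exact ho y
  · rw [inputLength_inclusionExclusion]
    refine Nat.add_le_add_right ((Nat.log_le_clog _ _).trans ?_) d
    change Nat.clog 2 (Fintype.card (InclExclPos N 1)) ≤ _
    have h₁ : Fintype.card (InclExclPos N 1) ≤ 2 ^ 3 * (N * N) := by
      rw [card_inclExclPos_one]
      have h₁ := clog_two_le_self (N + 1)
      have h₂ := Nat.mul_le_mul_left N (clog_two_le_self N)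
      nlinarith
    have h₂ := clog_two_mul_le (2 ^ 3) (N * N)
    have h₃ := clog_two_mul_le N N
    have h₅ := Nat.clog_le_of_le_pow (le_refl (2 ^ 3))
    have h₆ := Nat.clog_mono_right 2 h₁
    omega

theorem reducesDT_lossyCode_inclusionExclusion {C k : ℕ} (hC : 1 ≤ C) (hk : 1 ≤ k) :
    ReducesDT lossyCode (inclusionExclusion C k) := by
  have hpoly : PolyBounded fun u => 3 + 2 * (3 * (u + 2)) + 3 * 3 * (u + 2) := by
    have h := fun c => PolyBounded.id.add (PolyBounded.const c)
    have k := PolyBounded.const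
    exact ((k 3).add ((k 2).mul ((k 3).mul (h 2)))).add ((k _).mul (h 2))
  refine ReducesDT.of_polyBounded hpoly fun N => ?_
  set u := Nat.log 2 (lossyCode N).inputLength
  have hu : Nat.clog 2 N ≤ u + 1 := clog_le_log_inputLength_lossyCode N
  have hu' : Nat.clog 2 (2 * N) ≤ u + 2 := by
    have := clog_two_mul_two_le N
    omega
  have hN : 1 ≤ (N : ℕ) ^ 3 := Nat.one_le_pow _ _ N.pos
  have hN' : (2 * (N : ℕ)) ^ 3 = 8 * (N : ℕ) ^ 3 := by ring
  -- The cube is taken only so that the large side is at least 8, also for `N = 1`.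
  have hr : HasRetraction (lossyCode N) (Fin ((N : ℕ) ^ 3)) (Fin ((2 * (N : ℕ)) ^ 3)) _ :=
    ((hasRetraction_lossyCode N).pow 3).resize (by simp) (by simp)
  refine ⟨_, (hr.reduces_inclusionExclusion hC hk (by omega) (by omega)).mono ?_⟩
  have h₁ := clog_two_pow_le (2 * N) 3
  omega

/-! ### Counting colour patterns -/

theorem exists_perm_mem_iff {ι : Type} [Fintype ι] {s T : Finset ι} (h : s.card = T.card) :
    ∃ φ : Equiv.Perm ι, ∀ j, φ j ∈ s ↔ j ∈ T := by
  classical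
  let e : {j // j ∈ T} ≃ {j // j ∈ s} := Fintype.equivOfCardEq (by simp [h])
  refine ⟨e.extendSubtype, fun j => ⟨fun hj => ?_, fun hj => e.extendSubtype_mem j hj⟩⟩
  by_contra hj'
  exact e.extendSubtype_not_mem j hj' hj

/-- Both sides equal the multinomial coefficient `(2(r+m))! / (r!² m!²)`. -/
theorem choose_two_mul_mul_centralBinom (r m : ℕ) :
    (2 * (r + m)).choose (2 * r) * r.centralBinom * m.centralBinom =
      (r + m).choose r ^ 2 * (r + m).centralBinom := by
  have hcb : ∀ n : ℕ, n.centralBinom * n.factorial * n.factorial = (2 * n).factorial := fun n => by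
    rw [Nat.centralBinom, two_mul, Nat.add_choose_mul_factorial_mul_factorial]
  have h₁ := Nat.add_choose_mul_factorial_mul_factorial (2 * r) (2 * m)
  have h₂ := Nat.add_choose_mul_factorial_mul_factorial r m
  rw [← Nat.choose_symm_add] at h₂
  rw [← Nat.choose_symm_add, ← mul_add] at h₁
  have hpos : 0 < (r.factorial * m.factorial) ^ 2 * ((2 * r).factorial * (2 * m).factorial) := by
    positivity
  refine Nat.eq_of_mul_eq_mul_right hpos ?_
  calc _ = ((2 * (r + m)).choose (2 * r) * (2 * r).factorial * (2 * m).factorial) *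
        (r.centralBinom * r.factorial * r.factorial) *
        (m.centralBinom * m.factorial * m.factorial) := by ring
    _ = ((r + m).centralBinom * (r + m).factorial * (r + m).factorial) *
        ((2 * r).factorial * (2 * m).factorial) := by rw [h₁, hcb, hcb, hcb]; ring
    _ = _ := by rw [← h₂]; ring

theorem four_pow_le_mul_centralBinom (n : ℕ) : 4 ^ n ≤ (2 * n + 1) * n.centralBinom := by
  rcases Nat.eq_zero_or_pos n with rfl | hn
  · simp
  · exact (Nat.four_pow_le_two_mul_self_mul_centralBinom n hn).trans
      (Nat.mul_le_mul_right _ (Nat.le_succ _))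

theorem centralBinom_le_four_pow (n : ℕ) : n.centralBinom ≤ 4 ^ n := by
  have := Nat.choose_le_two_pow (2 * n) n
  rwa [pow_mul] at this

/-- Central binomials are `4^n` up to a factor `2n+1`, so the preceding identity says that
`C(2t,2r)` is `C(t,r)²` up to a polynomial factor; one of the two factors `C(t,r)` is then bounded
by `2^t`. -/
theorem choose_two_mul_le {t r : ℕ} (hr : r ≤ t) :
    (2 * t).choose (2 * r) ≤ (2 * t + 1) ^ 2 * 2 ^ t * t.choose r := by
  obtain ⟨m, rfl⟩ := Nat.exists_eq_add_of_le hr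
  have hid := choose_two_mul_mul_centralBinom r m
  have h₁ := four_pow_le_mul_centralBinom r
  have h₂ := four_pow_le_mul_centralBinom m
  have h₃ := centralBinom_le_four_pow (r + m)
  have h₄ := Nat.choose_le_two_pow (r + m) r
  refine Nat.le_of_mul_le_mul_right ?_ (by positivity : 0 < 4 ^ (r + m))
  calc (2 * (r + m)).choose (2 * r) * 4 ^ (r + m)
      = (2 * (r + m)).choose (2 * r) * (4 ^ r * 4 ^ m) := by rw [pow_add]
    _ ≤ (2 * (r + m)).choose (2 * r) *
        (((2 * r + 1) * r.centralBinom) * ((2 * m + 1) * m.centralBinom)) :=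
      Nat.mul_le_mul_left _ (Nat.mul_le_mul h₁ h₂)
    _ = ((2 * r + 1) * (2 * m + 1)) *
        ((2 * (r + m)).choose (2 * r) * r.centralBinom * m.centralBinom) := by ring
    _ = ((2 * r + 1) * (2 * m + 1)) * ((r + m).choose r * (r + m).choose r *
        (r + m).centralBinom) := by rw [hid, sq]
    _ ≤ ((2 * (r + m) + 1) * (2 * (r + m) + 1)) * (2 ^ (r + m) * (r + m).choose r *
        4 ^ (r + m)) :=
      Nat.mul_le_mul (Nat.mul_le_mul (by omega) (by omega))
        (Nat.mul_le_mul (Nat.mul_le_mul_right _ h₄) h₃)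
    _ = _ := by ring

theorem choose_add_choose_succ_le {t r : ℕ} (hr : r ≤ t) :
    (2 * t + 1).choose (2 * r) + (2 * t + 1).choose (2 * r + 1) ≤
      2 * (2 * t + 1) ^ 3 * 2 ^ t * t.choose r := by
  have h := choose_two_mul_le hr
  have h₁ : (2 * t + 1).choose (2 * r + 1) ≤ (2 * t + 1) * (2 * t).choose (2 * r) := by
    rw [Nat.add_one_mul_choose_eq]
    exact Nat.le_mul_of_pos_right _ (by omega)
  have h₂ : (2 * t + 1).choose (2 * r) ≤ (2 * t + 1) * (2 * t).choose (2 * r) := by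
    have := Nat.choose_mul_succ_eq (2 * t) (2 * r)
    rw [mul_comm (2 * t + 1), this]
    exact Nat.le_mul_of_pos_right _ (by omega)
  have h₃ := Nat.mul_le_mul_left (2 * t + 1) h
  calc _ ≤ 2 * ((2 * t + 1) * ((2 * t + 1) ^ 2 * 2 ^ t * t.choose r)) := by omega
    _ = _ := by ring

/-- Every colour pattern on `2t + 1` positions can be paired up monochromatically with one position
left over, in such a way that the pattern is determined by the colours of the pairs and a label from
a set of size about `2 ^ t`. -/
theorem exists_pairing (t : ℕ) :
    ∃ (q : Finset (Option (Fin t × Bool)) → Fin (2 * (2 * t + 1) ^ 3 * 2 ^ t))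
      (ρ : Finset (Option (Fin t × Bool)) → Finset (Fin t))
      (φ : Finset (Option (Fin t × Bool)) → Equiv.Perm (Option (Fin t × Bool))),
      (∀ s s', q s = q s' → ρ s = ρ s' → s = s') ∧
      ∀ s i b, φ s (some (i, b)) ∈ s ↔ i ∈ ρ s := by
  classical
  set Q := 2 * (2 * t + 1) ^ 3 * 2 ^ t with hQ
  have hcard : Fintype.card (Option (Fin t × Bool)) = 2 * t + 1 := by simp [mul_comm]
  have hle : ∀ s : Finset (Option (Fin t × Bool)), s.card / 2 ≤ t := fun s => by
    have := s.card_le_univ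
    omega
  -- A pattern with `2r` or `2r+1` ones has `r` pairs of colour 1. For each `r` such patterns are
  -- injected into labels times `r`-subsets of the pairs, so the subset reveals `r`.
  have hemb : ∀ r : Fin (t + 1), Nonempty ({s : Finset (Option (Fin t × Bool)) // s.card / 2 = r} ↪
      Fin Q × {ρ : Finset (Fin t) // ρ.card = r}) := fun r => by
    refine Function.Embedding.nonempty_of_card_le ?_
    rw [Fintype.card_prod, Fintype.card_fin, Fintype.card_finset_len, Fintype.card_fin]
    refine le_trans ?_ (choose_add_choose_succ_le (Nat.lt_succ_iff.1 r.2))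
    have hchoose : ∀ n, (2 * t + 1).choose n =
        (Finset.powersetCard n (Finset.univ : Finset (Option (Fin t × Bool)))).card := fun n => by
      rw [Finset.card_powersetCard, Finset.card_univ, hcard]
    rw [Fintype.card_subtype, hchoose, hchoose]
    refine le_trans (Finset.card_le_card fun s hs => ?_) (Finset.card_union_le _ _)
    simp only [Finset.mem_filter, Finset.mem_univ, true_and] at hs
    simp only [Finset.mem_union, Finset.mem_powersetCard, Finset.subset_univ, true_and]
    omega
  let e := fun r => (hemb r).some
  let val : Finset (Option (Fin t × Bool)) → Fin Q × Finset (Fin t) := fun s =>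
    let z := e ⟨s.card / 2, Nat.lt_succ_of_le (hle s)⟩ ⟨s, rfl⟩
    (z.1, z.2.1)
  have hval : ∀ s, (val s).2.card = s.card / 2 := fun s =>
    (e ⟨s.card / 2, Nat.lt_succ_of_le (hle s)⟩ ⟨s, rfl⟩).2.2
  have hφ : ∀ s : Finset (Option (Fin t × Bool)), ∃ φ : Equiv.Perm (Option (Fin t × Bool)),
      ∀ i b, φ (some (i, b)) ∈ s ↔ i ∈ (val s).2 := fun s => by
    -- The chosen pairs cover `2r` ones; the spare position `none` absorbs the last one when `|s|`
    -- is odd. A permutation carrying this set onto `s` is the pairing.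
    let T₀ : Finset (Option (Fin t × Bool)) := ((val s).2 ×ˢ Finset.univ).map Function.Embedding.some
    have hT₀ : T₀.card = 2 * (s.card / 2) := by
      simp [T₀, hval, mul_comm]
    have hn : none ∉ T₀ := by simp [T₀]
    obtain ⟨T, hT, hTs⟩ : ∃ T : Finset (Option (Fin t × Bool)), s.card = T.card ∧
        ∀ p, some p ∈ T ↔ some p ∈ T₀ := by
      rcases Nat.mod_two_eq_zero_or_one s.card with h | h
      · exact ⟨T₀, by omega, fun p => Iff.rfl⟩
      · exact ⟨insert none T₀, by rw [Finset.card_insert_of_notMem hn]; omega, by simp⟩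
    obtain ⟨φ, hφ⟩ := exists_perm_mem_iff hT
    refine ⟨φ, fun i b => ?_⟩
    rw [hφ, hTs]
    simp [T₀]
  choose φ hφ using hφ
  refine ⟨fun s => (val s).1, fun s => (val s).2, φ, fun s s' h₁ h₂ => ?_, hφ⟩
  dsimp only at h₁ h₂
  have hr : s.card / 2 = s'.card / 2 := by rw [← hval, ← hval, h₂]
  have key : ∀ (r r' : Fin (t + 1)) (hrr : r = r') (hs : s.card / 2 = r) (hs' : s'.card / 2 = r'),
      (e r ⟨s, hs⟩).1 = (e r' ⟨s', hs'⟩).1 → (e r ⟨s, hs⟩).2.1 = (e r' ⟨s', hs'⟩).2.1 → s = s' := by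
    rintro r _ rfl hs hs' h₁ h₂
    have := (e r).injective (Prod.ext h₁ (Subtype.ext h₂))
    exact congrArg Subtype.val this
  exact key _ _ (Fin.ext hr) rfl rfl h₁ h₂

/-! ### AMGM-LC and Dual-AMGM-LC belong to `Lossy` -/

namespace ColoringPos

variable {N K : ℕ}

/-- The value `F p`, if it is defined. -/
def optF (p : Fin K) (x : ColoringPos N K → Bool) : Option (Fin (2 * N) × Fin (2 * N)) :=
  (finOption _ (F x p).1).bind fun u => (finOption _ (F x p).2).map fun v => (u, v)

/-- The value `G w`, if it is defined. -/
def optG (w : Fin (2 * N) × Fin (2 * N)) (x : ColoringPos N K → Bool) : Option (Fin K) :=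
  finOption _ (G x w)

theorem optF_eq_some {p : Fin K} {x : ColoringPos N K → Bool} {u v : Fin (2 * N)} :
    optF p x = some (u, v) ↔ F x p = ((u : ℕ), (v : ℕ)) := by
  simp [optF, Option.bind_eq_some_iff, finOption_eq_some, Prod.ext_iff]

theorem optG_eq_some {w : Fin (2 * N) × Fin (2 * N)} {x : ColoringPos N K → Bool} {p : Fin K} :
    optG w x = some p ↔ G x w = p := finOption_eq_some

theorem hasDepthLE_optF (p : Fin K) :
    HasDepthLE (optF (N := N) p) (Nat.clog 2 (2 * N) + Nat.clog 2 (2 * N)) :=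
  ((HasDepthLE.tableEntry ColoringPos.fst p).prodMk (HasDepthLE.tableEntry ColoringPos.snd p)).map
    fun z => (finOption (2 * N) z.1).bind fun u => (finOption (2 * N) z.2).map fun v => (u, v)

theorem hasDepthLE_optG (w : Fin (2 * N) × Fin (2 * N)) :
    HasDepthLE (optG (K := K) w) (Nat.clog 2 K) :=
  (HasDepthLE.tableEntry ColoringPos.back w).map _

theorem hasDepthLE_C (v : Fin (2 * N)) :
    HasDepthLE (fun x : ColoringPos N K → Bool => C x v) 1 := HasDepthLE.bit _

/-- The set of positions of `w` with colour `1`. -/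
def ones {J : Type} [Fintype J] (w : J → Fin (2 * N)) (x : ColoringPos N K → Bool) : Finset J :=
  Finset.univ.filter fun j => C x (w j) = true

theorem mem_ones {J : Type} [Fintype J] {w : J → Fin (2 * N)} {x : ColoringPos N K → Bool} {j : J} :
    j ∈ ones w x ↔ C x (w j) = true := by simp [ones]

theorem hasDepthLE_ones {J : Type} [Fintype J] (w : J → Fin (2 * N)) :
    HasDepthLE (ones (K := K) w) (Fintype.card J) := by
  have := (HasDepthLE.pi fun j => hasDepthLE_C (K := K) (w j)).map
    fun v => Finset.univ.filter fun j => v j = true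
  change HasDepthLE (fun x => ones w x) _
  simpa [ones] using this

end ColoringPos

open ColoringPos in
theorem hasDepthLE_rel_amgmLC (c : ℝ) (N : ℕ+) (p : Fin ⌈c * (N : ℝ) ^ 2⌉₊) :
    HasDepthLE (fun x : ColoringPos N ⌈c * (N : ℝ) ^ 2⌉₊ → Bool => (amgmLC c N).Rel x p)
      (Nat.clog 2 (2 * N) + Nat.clog 2 (2 * N) + (1 + (1 + Nat.clog 2 ⌈c * (N : ℝ) ^ 2⌉₊))) := by
  let k : Option (Fin (2 * N) × Fin (2 * N)) → (ColoringPos N ⌈c * (N : ℝ) ^ 2⌉₊ → Bool) → Prop :=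
    fun o x => ∀ w, o = some w → ¬ ((C x w.1 = false ∧ C x w.2 = true) ∧ optG w x = some p)
  have h : (fun x : ColoringPos N ⌈c * (N : ℝ) ^ 2⌉₊ → Bool => (amgmLC c N).Rel x p) =
      fun x => k (optF p x) x := by
    funext x
    change (¬ _) = _
    simp only [k, not_exists, Prod.forall, optF_eq_some, optG_eq_some, not_and]
  rw [h]
  refine (hasDepthLE_optF p).bind (k := k) fun o => ?_
  cases o with
  | none => simpa [k] using HasDepthLE.const True _
  | some w =>
    have := ((hasDepthLE_C (K := ⌈c * (N : ℝ) ^ 2⌉₊) w.1).prodMk ((hasDepthLE_C w.2).prodMk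
      (hasDepthLE_optG w))).map
      fun z => ¬ ((z.1 = false ∧ z.2.1 = true) ∧ z.2.2 = some p)
    obtain ⟨u, v⟩ := w
    simpa [k] using this

open ColoringPos in
theorem hasDepthLE_rel_dualAmgmLC (c : ℝ) (N : ℕ+) (w : Fin (2 * N) × Fin (2 * N)) :
    HasDepthLE (fun x : ColoringPos N ⌊c * (N : ℝ) ^ 2⌋₊ → Bool => (dualAmgmLC c N).Rel x w)
      (1 + (1 + (Nat.clog 2 ⌊c * (N : ℝ) ^ 2⌋₊ + (Nat.clog 2 (2 * N) + Nat.clog 2 (2 * N))))) := by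
  have h : (fun x : ColoringPos N ⌊c * (N : ℝ) ^ 2⌋₊ → Bool => (dualAmgmLC c N).Rel x w) =
      fun x => C x w.1 = C x w.2 ∧ ((optG w x).bind fun h => optF h x) ≠ some w := by
    funext x
    obtain ⟨u, v⟩ := w
    change (_ ∧ ¬ _) = _
    simp only [ne_eq, Option.bind_eq_some_iff, optF_eq_some, optG_eq_some]
  rw [h]
  exact ((hasDepthLE_C w.1).prodMk ((hasDepthLE_C w.2).prodMk
    ((hasDepthLE_optG w).optionBind hasDepthLE_optF))).map
      fun z : Bool × Bool × Option (Fin (2 * N) × Fin (2 * N)) => z.1 = z.2.1 ∧ z.2.2 ≠ some w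

open ColoringPos in
-- A balanced pattern `s` and pigeons `p` are encoded by placing the second (colour 1) components of
-- the `F (p i)` on `s` and the first components off `s`. The decoder queries the colours to recover
-- `s`, regroups the word into pairs and applies `G`. If no `p i` is a solution, the colours of the
-- placed vertices are exactly `s` and decoding succeeds.
theorem hasRetraction_amgmLC (c : ℝ) (N : ℕ+) (t : ℕ) [NeZero t] :
    HasRetraction (amgmLC c N) (Fin t × Bool → Fin (2 * N))
      ({s : Finset (Fin t × Bool) // s.card = t} × (Fin t → Fin ⌈c * (N : ℝ) ^ 2⌉₊))
      (t * (2 * Nat.clog 2 (2 * N) + Nat.clog 2 ⌈c * (N : ℝ) ^ 2⌉₊ + 2)) := by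
  classical
  have hφ : ∀ s : {s : Finset (Fin t × Bool) // s.card = t},
      ∃ φ : Equiv.Perm (Fin t × Bool), ∀ j, φ j ∈ s.1 ↔ j ∈ Finset.univ ×ˢ {true} := fun s =>
    exists_perm_mem_iff (by simp [s.2])
  choose φ hφ using hφ
  choose sel hsel hspec using fun p : Fin t → Fin ⌈c * (N : ℝ) ^ 2⌉₊ =>
    HasDepthLE.exists_select fun i => hasDepthLE_rel_amgmLC c N (p i)
  let place : {s : Finset (Fin t × Bool) // s.card = t} → (Fin t → Fin (2 * N) × Fin (2 * N)) →
      Fin t × Bool → Fin (2 * N) := fun s v j =>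
    let i := (φ s).symm j
    if i.2 then (v i.1).2 else (v i.1).1
  let read : Finset (Fin t × Bool) → (Fin t × Bool → Fin (2 * N)) →
      (ColoringPos N ⌈c * (N : ℝ) ^ 2⌉₊ → Bool) →
      Option ({s : Finset (Fin t × Bool) // s.card = t} × (Fin t → Fin ⌈c * (N : ℝ) ^ 2⌉₊)) :=
    fun s w x => if hs : s.card = t then
      (optionPi fun i => optG (w (φ ⟨s, hs⟩ (i, false)), w (φ ⟨s, hs⟩ (i, true))) x).map
        (Prod.mk ⟨s, hs⟩) else none
  refine ⟨fun w x => read (ones w x) w x,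
    fun y x => (optionPi fun i => optF (y.2 i) x).map (place y.1),
    fun y x => y.2 (sel y.2 x), fun w => ?_, fun y => ?_, fun y => ?_,
    fun (x : ColoringPos N ⌈c * (N : ℝ) ^ 2⌉₊ → Bool) _ y hy => ?_⟩
  · refine ((hasDepthLE_ones w).bind (k := fun s => read s w)
      (e := t * Nat.clog 2 ⌈c * (N : ℝ) ^ 2⌉₊) fun s => ?_).mono ?_
    · by_cases hs : s.card = t
      · have := (HasDepthLE.pi fun i : Fin t => hasDepthLE_optG (K := ⌈c * (N : ℝ) ^ 2⌉₊)
          (w (φ ⟨s, hs⟩ (i, false)), w (φ ⟨s, hs⟩ (i, true)))).map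
          fun v => (optionPi v).map (Prod.mk (⟨s, hs⟩ : {s : Finset (Fin t × Bool) // s.card = t}))
        simpa [read, hs] using this
      · simpa [read, hs] using HasDepthLE.const _ _
    · simp only [Fintype.card_prod, Fintype.card_fin, Fintype.card_bool]
      nlinarith
  · refine ((HasDepthLE.pi fun i => hasDepthLE_optF (y.2 i)).map
      fun v => (optionPi v).map (place y.1)).mono ?_
    simp only [Fintype.card_fin]
    nlinarith
  · refine ((hsel y.2).map y.2).mono (le_of_eq ?_)
    simp only [Fintype.card_fin]
    ring
  · obtain ⟨s, p⟩ := y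
    refine hspec p x ?_
    by_contra! H
    refine hy (Option.bind_eq_some_iff.2 ?_)
    have H' : ∀ i, ∃ u v : Fin (2 * N), F x (p i) = ((u : ℕ), (v : ℕ)) ∧
        (C x u = false ∧ C x v = true) ∧ G x (u, v) = p i := fun i => not_not.1 (H i)
    choose u v hF hC hG using H'
    refine ⟨place s fun i => (u i, v i), ?_, ?_⟩
    · rw [Option.map_eq_some_iff]
      exact ⟨_, optionPi_eq_some.2 fun i => optF_eq_some.2 (hF i), rfl⟩
    · have hplace : ∀ i b, place s (fun i => (u i, v i)) (φ s (i, b)) = if b then v i else u i :=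
        fun i b => by simp [place]
      have hones : ones (place s fun i => (u i, v i)) x = s.1 := by
        ext j
        obtain ⟨⟨i, b⟩, rfl⟩ := (φ s).surjective j
        rw [mem_ones, hplace, hφ]
        cases b <;> simp [hC]
      simp only [hones, read, s.2, dite_true]
      rw [Option.map_eq_some_iff]
      refine ⟨p, optionPi_eq_some.2 fun i => ?_, rfl⟩
      rw [hplace, hplace]
      exact optG_eq_some.2 (hG i)

open ColoringPos in
-- A word is stored as the label of its colour pattern, its spare vertex and the holes of its
-- monochromatic pairs. To restore it, `F` is applied to the holes and the colours of the pairs are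
-- queried; with the label they determine the pattern, hence where each vertex belongs.
theorem hasRetraction_dualAmgmLC (c : ℝ) (N : ℕ+) (t : ℕ) [NeZero t] :
    HasRetraction (dualAmgmLC c N)
      ((Fin (2 * (2 * t + 1) ^ 3 * 2 ^ t) × Fin (2 * N)) × (Fin t → Fin ⌊c * (N : ℝ) ^ 2⌋₊))
      (Option (Fin t × Bool) → Fin (2 * N))
      (t * (2 * Nat.clog 2 (2 * N) + Nat.clog 2 ⌊c * (N : ℝ) ^ 2⌋₊ + 4) + 1) := by
  classical
  obtain ⟨q, ρ, φ, hinj, hφ⟩ := exists_pairing t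
  let pair : Finset (Option (Fin t × Bool)) → (Option (Fin t × Bool) → Fin (2 * N)) → Fin t →
      Fin (2 * N) × Fin (2 * N) :=
    fun s w i => (w (φ s (some (i, false))), w (φ s (some (i, true))))
  choose sel hsel hspec using fun (w : Option (Fin t × Bool) → Fin (2 * N)) s =>
    HasDepthLE.exists_select fun i => hasDepthLE_rel_dualAmgmLC c N (pair s w i)
  let place : Finset (Option (Fin t × Bool)) → Fin (2 * N) → (Fin t → Fin (2 * N) × Fin (2 * N)) →
      Option (Fin t × Bool) → Fin (2 * N) := fun s v u j =>
    ((φ s).symm j).elim v fun i => if i.2 then (u i.1).2 else (u i.1).1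
  -- An arbitrary pattern is taken for label and subset that belong to none; only values on genuine
  -- patterns are used.
  let pattern : Fin (2 * (2 * t + 1) ^ 3 * 2 ^ t) → Finset (Fin t) →
      Finset (Option (Fin t × Bool)) := fun b r => Classical.epsilon fun s => q s = b ∧ ρ s = r
  have hpattern : ∀ s, pattern (q s) (ρ s) = s := fun s => by
    have := Classical.epsilon_spec (p := fun s' => q s' = q s ∧ ρ s' = ρ s) ⟨s, rfl, rfl⟩
    exact hinj _ _ this.1 this.2
  refine ⟨fun a x => (optionPi fun i => optF (a.2 i) x).bind fun u =>
      some (place (pattern a.1.1 (ones (fun i => (u i).1) x)) a.1.2 u),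
    fun w x => (optionPi fun i => optG (pair (ones w x) w i) x).map
      (Prod.mk (q (ones w x), w (φ (ones w x) none))),
    fun w x => pair (ones w x) w (sel w (ones w x) x),
    fun a => ?_, fun w => ?_, fun w => ?_,
    fun (x : ColoringPos N ⌊c * (N : ℝ) ^ 2⌋₊ → Bool) _ w hw => ?_⟩
  · refine (((HasDepthLE.pi fun i => hasDepthLE_optF (a.2 i)).map optionPi).optionBind
      fun u => (hasDepthLE_ones _).map fun s => some (place (pattern a.1.1 s) a.1.2 u)).mono ?_
    simp only [Fintype.card_fin]
    nlinarith
  · refine ((hasDepthLE_ones w).bind (k := fun s x => (optionPi fun i => optG (pair s w i) x).map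
      (Prod.mk (q s, w (φ s none)))) fun s => ((HasDepthLE.pi fun i =>
      hasDepthLE_optG (pair s w i)).map fun v => (optionPi v).map (Prod.mk (q s, w (φ s none))))).mono ?_
    simp only [Fintype.card_prod, Fintype.card_fin, Fintype.card_bool, Fintype.card_option]
    nlinarith
  · refine ((hasDepthLE_ones w).bind (k := fun s x => pair s w (sel w s x)) fun s => (hsel w s).map (pair s w)).mono ?_
    simp only [Fintype.card_prod, Fintype.card_fin, Fintype.card_bool, Fintype.card_option]
    nlinarith
  · refine hspec w (ones w x) x ?_
    by_contra! H
    refine hw (Option.bind_eq_some_iff.2 ?_)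
    set s := ones w x with hs
    have hcol : ∀ i b, C x (w (φ s (some (i, b)))) = decide (i ∈ ρ s) := fun i b => by
      rw [Bool.eq_iff_iff, decide_eq_true_iff, ← hφ s i b, hs, mem_ones]
    have H' : ∀ i, ∃ h : Fin ⌊c * (N : ℝ) ^ 2⌋₊, G x (pair s w i) = h ∧
        F x h = (((pair s w i).1 : ℕ), ((pair s w i).2 : ℕ)) := fun i => by
      -- The pair is monochromatic by `hcol`, so not being a solution forces `F (G ·)` to return it.
      by_contra hi
      exact H i ⟨by simp only [pair, hcol], hi⟩
    choose h hG hF using H'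
    refine ⟨((q s, w (φ s none)), h), ?_, ?_⟩
    · rw [Option.map_eq_some_iff]
      exact ⟨h, optionPi_eq_some.2 fun i => optG_eq_some.2 (hG i), rfl⟩
    · refine Option.bind_eq_some_iff.2 ⟨pair s w,
        optionPi_eq_some.2 fun i => optF_eq_some.2 (hF i), ?_⟩
      have hones : ones (fun i => (pair s w i).1) x = ρ s := by
        ext i
        simp [mem_ones, pair, hcol]
      simp only [hones, hpattern, Option.some.injEq]
      funext j
      obtain ⟨i, rfl⟩ := (φ s).surjective j
      rcases i with _ | ⟨i, _ | _⟩ <;> simp [place, pair]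

/-! ### Choosing the constant word length for the colouring problems -/

theorem exists_mul_pow_le_pow {r : ℝ} (hr : 1 < r) (b k : ℕ) :
    ∃ t : ℕ, 0 < t ∧ (b : ℝ) * (t : ℝ) ^ k ≤ r ^ t := by
  have h := tendsto_pow_const_div_const_pow_of_one_lt k hr
  have h₁ : ∀ᶠ t : ℕ in Filter.atTop, (t : ℝ) ^ k / r ^ t < 1 / (b + 1) :=
    h.eventually_lt_const (by positivity)
  obtain ⟨t, ht, ht'⟩ := (h₁.and (Filter.eventually_gt_atTop 0)).exists
  refine ⟨t, ht', ?_⟩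
  rw [div_lt_div_iff₀ (by positivity) (by positivity)] at ht
  nlinarith [pow_nonneg (Nat.cast_nonneg (α := ℝ) t) k]

theorem le_inputLength_amgmLC (c : ℝ) (N : ℕ+) : (N : ℕ) ≤ (amgmLC c N).inputLength := by
  rw [inputLength_amgmLC, card_coloringPos]
  omega

theorem le_inputLength_dualAmgmLC (c : ℝ) (N : ℕ+) : (N : ℕ) ≤ (dualAmgmLC c N).inputLength := by
  rw [inputLength_dualAmgmLC, card_coloringPos]
  omega

theorem clog_le_log_add_one_of_le {N n : ℕ} (h : N ≤ n) : Nat.clog 2 N ≤ Nat.log 2 n + 1 :=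
  (clog_two_le_log_add_one _).trans (Nat.add_le_add_right (Nat.log_mono_right h) 1)

theorem inLossy_amgmLC {c : ℝ} (hc : 1 < c) : InLossy (amgmLC c) := by
  -- `c^t ≥ 4t` pays for the loss `2t` in `4^t ≤ 2t · C(2t,t)` and for the required factor 2.
  obtain ⟨t, ht, hct⟩ := exists_mul_pow_le_pow hc 4 1
  have : NeZero t := ⟨ht.ne'⟩
  set b := Nat.clog 2 ⌈c⌉₊
  set e := Nat.clog 2 ((2 * t).choose t)
  have hpoly : PolyBounded fun u => (e + t * (b + 2 * (u + 1))) +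
      t * (2 * (u + 2) + (b + 2 * (u + 1)) + 2) := by
    have h := fun c => PolyBounded.id.add (PolyBounded.const c)
    have k := PolyBounded.const
    have hb := (k b).add ((k 2).mul (h 1))
    exact ((k e).add ((k t).mul hb)).add ((k t).mul ((((k 2).mul (h 2)).add hb).add (k 2)))
  refine inLossy_of_hasRetraction hpoly fun N => ⟨_, _, inferInstance, inferInstance, _,
    hasRetraction_amgmLC c N t, ?_⟩
  set u := Nat.log 2 (amgmLC c N).inputLength
  have hu : Nat.clog 2 N ≤ u + 1 := clog_le_log_add_one_of_le (le_inputLength_amgmLC c N)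
  have hu' := clog_two_mul_two_le N
  have hcardA : Fintype.card (Fin t × Bool → Fin (2 * N)) = 4 ^ t * ((N : ℕ) ^ 2) ^ t := by
    simp only [Fintype.card_fun, Fintype.card_fin, Fintype.card_prod, Fintype.card_bool]
    rw [mul_comm t 2, pow_mul, mul_pow, mul_pow]
    norm_num
  have hcardB : Fintype.card ({s : Finset (Fin t × Bool) // s.card = t} ×
      (Fin t → Fin ⌈c * (N : ℝ) ^ 2⌉₊)) = (2 * t).choose t * ⌈c * (N : ℝ) ^ 2⌉₊ ^ t := by
    rw [Fintype.card_prod, Fintype.card_finset_len]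
    simp [mul_comm t 2]
  have hle : 2 * (4 ^ t * ((N : ℕ) ^ 2) ^ t) ≤ (2 * t).choose t * ⌈c * (N : ℝ) ^ 2⌉₊ ^ t := by
    have h₁ : (4 : ℝ) ^ t ≤ 2 * t * (2 * t).choose t := by
      exact_mod_cast Nat.four_pow_le_two_mul_self_mul_centralBinom t ht
    have h₂ : (c * (N : ℝ) ^ 2) ^ t ≤ (⌈c * (N : ℝ) ^ 2⌉₊ : ℝ) ^ t :=
      pow_le_pow_left₀ (by positivity) (Nat.le_ceil _) t
    rw [mul_pow] at h₂
    have h₃ : (2 : ℝ) * (4 ^ t * ((N : ℝ) ^ 2) ^ t) ≤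
        (2 * t).choose t * (⌈c * (N : ℝ) ^ 2⌉₊ : ℝ) ^ t :=
      calc (2 : ℝ) * (4 ^ t * ((N : ℝ) ^ 2) ^ t)
          ≤ 2 * ((2 * t * (2 * t).choose t) * ((N : ℝ) ^ 2) ^ t) := by gcongr
        _ = (2 * t).choose t * (((4 : ℕ) * (t : ℝ) ^ 1) * ((N : ℝ) ^ 2) ^ t) := by push_cast; ring
        _ ≤ (2 * t).choose t * (c ^ t * ((N : ℝ) ^ 2) ^ t) := by gcongr
        _ ≤ _ := by gcongr
    exact_mod_cast h₃
  have hpos : 0 < 4 ^ t * ((N : ℕ) ^ 2) ^ t := by have := N.pos; positivity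
  have hK : Nat.clog 2 ⌈c * (N : ℝ) ^ 2⌉₊ ≤ b + 2 * (u + 1) := by
    have h₁ : ⌈c * (N : ℝ) ^ 2⌉₊ ≤ ⌈c⌉₊ * (N : ℕ) ^ 2 := by
      refine Nat.ceil_le.2 ?_
      push_cast
      exact mul_le_mul_of_nonneg_right (Nat.le_ceil c) (by positivity)
    have h₂ := clog_two_mul_le ⌈c⌉₊ ((N : ℕ) ^ 2)
    have h₃ := clog_two_pow_le N 2
    have h₄ := Nat.clog_mono_right 2 h₁
    omega
  rw [hcardA, hcardB]
  refine ⟨hle, by omega, add_le_add ?_ (Nat.mul_le_mul_left t (by omega))⟩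
  exact (clog_two_mul_le _ _).trans (Nat.add_le_add_left
    ((clog_two_pow_le _ _).trans (Nat.mul_le_mul_left t hK)) e)

theorem inLossy_dualAmgmLC {c : ℝ} (hc : 0 < c) (hc₂ : c < 2) : InLossy (dualAmgmLC c) := by
  -- The label set has size `2(2t+1)³ 2^t ≤ 54 t³ 2^t`; with the required factor 2 this gives `108
  -- t³`.
  obtain ⟨t, ht, hct⟩ := exists_mul_pow_le_pow ((one_lt_div hc).2 hc₂) 108 3
  have : NeZero t := ⟨ht.ne'⟩
  have hpoly : PolyBounded fun u => (2 * t + 1) * (u + 2) +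
      (t * (2 * (u + 2) + (1 + 2 * (u + 1)) + 4) + 1) := by
    have h := fun c => PolyBounded.id.add (PolyBounded.const c)
    have k := PolyBounded.const
    exact ((k _).mul (h 2)).add (((k t).mul ((((k 2).mul (h 2)).add
      ((k 1).add ((k 2).mul (h 1)))).add (k 4))).add (k 1))
  refine inLossy_of_hasRetraction hpoly fun N => ⟨_, _, inferInstance, inferInstance, _,
    hasRetraction_dualAmgmLC c N t, ?_⟩
  set u := Nat.log 2 (dualAmgmLC c N).inputLength
  have hu : Nat.clog 2 N ≤ u + 1 := clog_le_log_add_one_of_le (le_inputLength_dualAmgmLC c N)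
  have hu' := clog_two_mul_two_le N
  set Q := 2 * (2 * t + 1) ^ 3 * 2 ^ t with hQ
  have hcardA : Fintype.card ((Fin Q × Fin (2 * N)) × (Fin t → Fin ⌊c * (N : ℝ) ^ 2⌋₊)) =
      Q * (2 * N) * ⌊c * (N : ℝ) ^ 2⌋₊ ^ t := by simp
  have hcardB : Fintype.card (Option (Fin t × Bool) → Fin (2 * N)) = (2 * N) ^ (2 * t + 1) := by
    simp [mul_comm t 2]
  have hle : 2 * (Q * (2 * N) * ⌊c * (N : ℝ) ^ 2⌋₊ ^ t) ≤ (2 * N) ^ (2 * t + 1) := by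
    have h₂ : (⌊c * (N : ℝ) ^ 2⌋₊ : ℝ) ^ t ≤ (c * (N : ℝ) ^ 2) ^ t :=
      pow_le_pow_left₀ (by positivity) (Nat.floor_le (by positivity)) t
    rw [mul_pow] at h₂
    have h₁ : (2 * t + 1 : ℝ) ^ 3 ≤ 27 * (t : ℝ) ^ 3 := by
      have : (1 : ℝ) ≤ t := by exact_mod_cast ht
      calc (2 * t + 1 : ℝ) ^ 3 ≤ (3 * t) ^ 3 := by gcongr; linarith
        _ = _ := by ring
    have h₃ : 108 * (t : ℝ) ^ 3 * c ^ t ≤ 2 ^ t := by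
      rw [div_pow, le_div_iff₀ (by positivity)] at hct
      exact_mod_cast hct
    have h₄ : (2 : ℝ) * (Q * (2 * N) * (⌊c * (N : ℝ) ^ 2⌋₊ : ℝ) ^ t) ≤ (2 * N) ^ (2 * t + 1) :=
      calc (2 : ℝ) * (Q * (2 * N) * (⌊c * (N : ℝ) ^ 2⌋₊ : ℝ) ^ t)
          ≤ 2 * ((2 * (27 * (t : ℝ) ^ 3) * 2 ^ t) * (2 * N) * (c ^ t * ((N : ℝ) ^ 2) ^ t)) := by
            rw [hQ]
            push_cast
            gcongr
        _ = (108 * (t : ℝ) ^ 3 * c ^ t) * 2 ^ t * (2 * N) * ((N : ℝ) ^ 2) ^ t := by ring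
        _ ≤ 2 ^ t * 2 ^ t * (2 * N) * ((N : ℝ) ^ 2) ^ t := by gcongr
        _ = _ := by ring
    exact_mod_cast h₄
  have hK : Nat.clog 2 ⌊c * (N : ℝ) ^ 2⌋₊ ≤ 1 + 2 * (u + 1) := by
    have h₁ : ⌊c * (N : ℝ) ^ 2⌋₊ ≤ 2 * (N : ℕ) ^ 2 := by
      refine Nat.floor_le_of_le ?_
      push_cast
      exact mul_le_mul_of_nonneg_right hc₂.le (by positivity)
    have h₂ := clog_two_mul_two_le ((N : ℕ) ^ 2)
    have h₃ := clog_two_pow_le N 2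
    have h₄ := Nat.clog_mono_right 2 h₁
    omega
  rw [hcardA, hcardB]
  refine ⟨hle, ?_, add_le_add ?_ (Nat.add_le_add_right (Nat.mul_le_mul_left t (by omega)) 1)⟩
  · exact (by have := N.pos; omega : 2 ≤ 2 * (N : ℕ)).trans (Nat.le_self_pow (by omega) _)
  · exact (clog_two_pow_le _ _).trans (Nat.mul_le_mul_left _ (by omega))

/-! ### Inclusion-Exclusion belongs to `Lossy` -/

theorem HasRetractionOn.of_forall_rel {R : SearchProblem} {s : Set (R.Pos → Bool)} [Nonempty R.Out]
    (h : ∀ x ∈ s, ∀ o, R.Rel x o) (A B : Type) (d : ℕ) : HasRetractionOn R s A B d :=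
  ⟨fun _ _ => none, fun _ _ => none, fun _ _ => Classical.arbitrary _, fun _ => .const _ _,
    fun _ => .const _ _, fun _ => .const _ _, fun x hx _ _ => h x hx _⟩

/-- The least index at which `r` is true, if there is one. -/
def firstTrue {l : ℕ} (r : Fin l → Bool) : Option (Fin l) :=
  if h : (Finset.univ.filter fun i => r i = true).Nonempty then some (Finset.min' _ h) else none

theorem exists_firstTrue {l : ℕ} {r : Fin l → Bool} {i : Fin l} (hi : r i = true) :
    ∃ j ≤ i, firstTrue r = some j ∧ r j = true := by
  have hmem : i ∈ Finset.univ.filter fun i => r i = true := by simpa using hi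
  have h : (Finset.univ.filter fun i => r i = true).Nonempty := ⟨i, hmem⟩
  exact ⟨_, Finset.min'_le _ _ hmem, dif_pos h, (Finset.mem_filter.1 (Finset.min'_mem _ h)).2⟩

namespace InclExclPos

variable {N l : ℕ}

/-- The membership of `y` in the sets. -/
def row (y : Fin N) (x : InclExclPos N l → Bool) : Fin l → Bool := fun i => x (.mem i y)

theorem hasDepthLE_row (y : Fin N) : HasDepthLE (row (l := l) y) l := by
  have := HasDepthLE.pi fun i : Fin l => HasDepthLE.bit (InclExclPos.mem i y)
  change HasDepthLE (fun x i => x (mem i y)) l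
  simpa using this

/-- The numbers in the input. -/
def numbers (x : InclExclPos N l → Bool) : (Fin l → ℕ) × (IndexPair l → ℕ) := (a x, a₂ x)

theorem hasDepthLE_numbers : HasDepthLE (numbers (N := N) (l := l))
    ((l + l * l) * Nat.clog 2 (N + 1)) := by
  have h := (HasDepthLE.pi fun i : Fin l => HasDepthLE.tableEntry (M := N + 1)
    (InclExclPos.card (N := N)) i).prodMk
    (HasDepthLE.pi fun p : IndexPair l => HasDepthLE.tableEntry (M := N + 1)
    (InclExclPos.cardInter (N := N)) p)
  refine HasDepthLE.mono h ?_
  have : Fintype.card (IndexPair l) ≤ l * l :=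
    (Fintype.card_subtype_le _).trans (by simp)
  rw [add_mul, Fintype.card_fin]
  exact Nat.add_le_add_left (Nat.mul_le_mul_right _ this) _

end InclExclPos

/-- The number of elements that the union may have at most, as a function of the numbers in the
input. -/
noncomputable def unionBound {C k : ℕ} (P : InclExclParam C k)
    (c : (Fin P.l → ℕ) × (IndexPair P.l → ℕ)) : ℕ :=
  ⌊((∑ i, (c.1 i : ℤ) - ∑ p, (c.2 p : ℤ) : ℤ) : ℝ) - P.ε * P.N⌋₊

open InclExclPos in
-- Bonferroni by an injection: a point `z` of `S_i` is sent to the union if `i` is the least index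
-- of a set containing `z`, and otherwise to `S_j ∩ S_i` with `j` that least index. The inverse
-- sends a point of the union to its least set, and a point of `S_j ∩ S_i` to the set with the
-- larger index. Fixing the numbers fixes the domains.
theorem hasRetractionOn_inclusionExclusion {C k : ℕ} (P : InclExclParam C k)
    (a₀ : Fin P.l → ℕ) (b₀ : IndexPair P.l → ℕ) (hl : 0 < P.l) (h₁ : ∀ i, a₀ i ≤ P.N)
    (h₂ : ∀ p, b₀ p ≤ P.N) (hL : unionBound P (a₀, b₀) ≤ P.l * P.N) :
    HasRetractionOn (inclusionExclusion C k P) {x | numbers x = (a₀, b₀)}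
      (Fin (unionBound P (a₀, b₀)) ⊕ Σ p, Fin (b₀ p)) (Σ i, Fin (a₀ i))
      (2 * Nat.clog 2 P.N + P.l + Nat.clog 2 (P.l * P.N)) := by
  set L := unionBound P (a₀, b₀) with hLdef
  have hlog : Nat.clog 2 P.N ≤ Nat.clog 2 (P.l * P.N) :=
    Nat.clog_mono_right 2 (Nat.le_mul_of_pos_left P.N hl)
  have hf : ∀ i y, HasDepthLE (fun x : InclExclPos P.N P.l → Bool => finOption P.N (f x i y))
      (Nat.clog 2 P.N) := fun i y => (HasDepthLE.tableEntry InclExclPos.single (i, y)).map _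
  have hg : ∀ i y, HasDepthLE (fun x : InclExclPos P.N P.l → Bool => g x i y)
      (Nat.clog 2 P.N) := fun i y => HasDepthLE.tableEntry InclExclPos.singleBack (i, y)
  have hf₂ : ∀ p y, HasDepthLE (fun x : InclExclPos P.N P.l → Bool => finOption P.N (f₂ x p y))
      (Nat.clog 2 P.N) := fun p y => (HasDepthLE.tableEntry InclExclPos.inter (p, y)).map _
  have hg₂ : ∀ p y, HasDepthLE (fun x : InclExclPos P.N P.l → Bool => g₂ x p y)
      (Nat.clog 2 P.N) := fun p y => HasDepthLE.tableEntry InclExclPos.interBack (p, y)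
  have hfU : ∀ z, HasDepthLE (fun x : InclExclPos P.N P.l → Bool => finOption P.N (fUnion x z))
      (Nat.clog 2 P.N) := fun z => (HasDepthLE.tableEntry InclExclPos.union z).map _
  have hgU : ∀ y, HasDepthLE (fun x : InclExclPos P.N P.l → Bool => gUnion x y)
      (Nat.clog 2 (P.l * P.N)) := fun y => HasDepthLE.tableEntry InclExclPos.unionBack y
  have hrow := fun y => hasDepthLE_row (N := P.N) (l := P.l) y
  let back : (i : Fin P.l) → Fin P.N → (InclExclPos P.N P.l → Bool) → Option (Σ i, Fin (a₀ i)) :=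
    fun i y x => (finOption (a₀ i) (g x i y)).map (Sigma.mk i)
  have hback : ∀ i y, HasDepthLE (back i y) (Nat.clog 2 P.N) := fun i y =>
    (hg i y).map fun n => (finOption (a₀ i) n).map fun y => (⟨i, y⟩ : Σ i, Fin (a₀ i))
  let fwd : (i j : Fin P.l) → Fin P.N → (InclExclPos P.N P.l → Bool) →
      Option (Fin L ⊕ Σ p, Fin (b₀ p)) := fun i j z x =>
    if h : j < i then
      (finOption (b₀ ⟨(j, i), h⟩) (g₂ x ⟨(j, i), h⟩ z)).map fun y => .inr ⟨_, y⟩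
    else (finOption L (gUnion x z)).map .inl
  have hfwd : ∀ i j z, HasDepthLE (fwd i j z) (Nat.clog 2 (P.l * P.N)) := fun i j z => by
    by_cases h : j < i
    · simp only [fwd, h, dite_true]
      exact ((hg₂ ⟨(j, i), h⟩ z).map fun n => (finOption (b₀ ⟨(j, i), h⟩) n).map
        fun y => (Sum.inr ⟨_, y⟩ : Fin L ⊕ Σ p, Fin (b₀ p))).mono hlog
    · simp only [fwd, h, dite_false]
      exact (hgU z).map fun n => (finOption L n).map Sum.inl
  -- The blame follows the route of the point: first the certificate of `S_i`, then that of `S_j ∩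
  -- S_i` if `j < i`, else that of the union.
  let sol : (i : Fin P.l) → Fin P.N → Fin P.N → (Fin P.l → Bool) × ℕ →
      (Fin P.l × Fin P.N) ⊕ (IndexPair P.l × Fin P.N) ⊕ Fin P.N := fun i y z r =>
    if r.1 i = true ∧ r.2 = y then
      (firstTrue r.1).elim (.inl (i, y)) fun j =>
        if h : j < i then .inr (.inl (⟨(j, i), h⟩, z)) else .inr (.inr z)
    else .inl (i, y)
  let F : (Fin L ⊕ Σ p, Fin (b₀ p)) → (InclExclPos P.N P.l → Bool) → Option (Σ i, Fin (a₀ i)) :=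
    Sum.elim (fun z x => (finOption P.N (fUnion x (z.castLE hL))).bind fun y =>
        (firstTrue (row y x)).bind fun i => back i y x)
      fun q x => (finOption P.N (f₂ x q.1 (q.2.castLE (h₂ _)))).bind fun y => back q.1.1.2 y x
  let G : (Σ i, Fin (a₀ i)) → (InclExclPos P.N P.l → Bool) → Option (Fin L ⊕ Σ p, Fin (b₀ p)) :=
    fun q x => (finOption P.N (f x q.1 (q.2.castLE (h₁ _)))).bind fun z =>
      (firstTrue (row z x)).bind fun j => fwd q.1 j z x
  let out : (Σ i, Fin (a₀ i)) → (InclExclPos P.N P.l → Bool) →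
      (Fin P.l × Fin P.N) ⊕ (IndexPair P.l × Fin P.N) ⊕ Fin P.N := fun q x =>
    (fun o x => Option.elim o (.inl (q.1, q.2.castLE (h₁ _))) fun z =>
      sol q.1 (q.2.castLE (h₁ _)) z (row z x, g x q.1 z))
      (finOption P.N (f x q.1 (q.2.castLE (h₁ _)))) x
  refine ⟨F, G, out, fun q => ?_, fun q => ?_, fun q => ?_, fun x hx q hq => ?_⟩
  · rcases q with z | q
    · refine ((hfU (z.castLE hL)).optionBind fun y => ((hrow y).map firstTrue).optionBind
        fun i => hback i y).mono ?_
      omega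
    · exact ((hf₂ q.1 (q.2.castLE (h₂ _))).optionBind fun y => hback q.1.1.2 y).mono (by omega)
  · refine ((hf q.1 (q.2.castLE (h₁ _))).optionBind fun z => ((hrow z).map firstTrue).optionBind
      fun j => hfwd q.1 j z).mono ?_
    omega
  · refine ((hf q.1 (q.2.castLE (h₁ _))).bind (k := fun o x => Option.elim o
      (.inl (q.1, q.2.castLE (h₁ _))) fun z => sol q.1 (q.2.castLE (h₁ _)) z (row z x, g x q.1 z))
      (e := P.l + Nat.clog 2 P.N) fun o => ?_).mono ?_
    · cases o with
      | none => exact HasDepthLE.const _ _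
      | some z => exact ((hrow z).prodMk (hg q.1 z)).map (sol q.1 (q.2.castLE (h₁ _)) z)
    · omega
  · obtain ⟨i, y⟩ := q
    change (InclExclPos P.N P.l → Bool) at x
    have hxa : a x = a₀ := congrArg Prod.fst hx
    have hxb : a₂ x = b₀ := congrArg Prod.snd hx
    have hxL : ⌊(aTilde x : ℝ) - P.ε * P.N⌋₊ = L := by
      rw [hLdef, aTilde, hxa, hxb]
      rfl
    obtain ⟨y', hy'⟩ : ∃ y' : Fin P.N, y' = y.castLE (h₁ i) := ⟨_, rfl⟩
    have hy : (y' : ℕ) = y := congrArg Fin.val hy'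
    have rel_of_eq : ∀ o, out ⟨i, y⟩ x = o → (inclusionExclusion C k P).Rel x o →
        (inclusionExclusion C k P).Rel x (out ⟨i, y⟩ x) := fun o ho h => by
      rw [ho]
      exact h
    have hbad : (¬ ∃ z : Fin P.N, f x i y' = z ∧ T x i z ∧ g x i z = y') →
        (inclusionExclusion C k P).Rel x (.inl (i, y')) := fun h _ => by
      refine ⟨?_, h⟩
      rw [hxa, hy]
      exact y.2
    by_cases hz : ∃ z : Fin P.N, f x i y' = z ∧ T x i z ∧ g x i z = y'
    swap
    · refine rel_of_eq (.inl (i, y')) ?_ (hbad hz)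
      simp only [out, ← hy']
      cases ho : finOption P.N (f x i y') with
      | none => rfl
      | some z =>
        refine if_neg fun h => hz ⟨z, finOption_eq_some.1 ho, h.1, h.2⟩
    obtain ⟨z, hfz, hTz, hgz⟩ := hz
    have hz := finOption_eq_some.2 hfz
    obtain ⟨j, hji, hj, hTj⟩ := exists_firstTrue (r := row z x) (i := i) hTz
    have hb : back i z x = some ⟨i, y⟩ := by
      have : finOption (a₀ i) (g x i z) = some y := finOption_eq_some.2 (hgz.trans hy)
      simp only [back, this, Option.map_some]
    have hG : G ⟨i, y⟩ x = fwd i j z x := by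
      simp only [G, ← hy', hz, Option.bind_some, hj]
    have hq' : (fwd i j z x).bind (fun p => F p x) ≠ some ⟨i, y⟩ := by
      rw [← hG]
      exact hq
    have hgood : row z x i = true ∧ g x i z = y' := ⟨hTz, hgz⟩
    by_cases h : j < i
    · refine rel_of_eq (.inr (.inl (⟨(j, i), h⟩, z))) ?_ fun _ => ⟨⟨hTj, hTz⟩, ?_⟩
      · simp only [out, ← hy', hz, Option.elim_some, sol, hgood, hj, h, and_self, if_true, dite_true]
      · rintro ⟨w, hw, hgw, hfw⟩
        rw [hxb] at hw
        refine hq' (Option.bind_eq_some_iff.2 ⟨.inr ⟨⟨(j, i), h⟩, ⟨w, hw⟩⟩, ?_, ?_⟩)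
        · have : finOption (b₀ ⟨(j, i), h⟩) (g₂ x ⟨(j, i), h⟩ z) = some ⟨w, hw⟩ :=
            finOption_eq_some.2 hgw
          simp only [fwd, h, dite_true, this, Option.map_some]
        · have : finOption P.N (f₂ x ⟨(j, i), h⟩ w) = some z := finOption_eq_some.2 hfw
          exact Option.bind_eq_some_iff.2 ⟨z, this, hb⟩
    · obtain rfl : j = i := le_antisymm hji (not_lt.1 h)
      refine rel_of_eq (.inr (.inr z)) ?_ fun _ => ⟨⟨j, hTz⟩, ?_⟩
      · simp only [out, ← hy', hz, Option.elim_some, sol, hgood, hj, h, and_self, if_true,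
          dite_false]
      · rintro ⟨w, hw, hgw, hfw⟩
        have hw : (w : ℕ) < L := hxL ▸ hw
        refine hq' (Option.bind_eq_some_iff.2 ⟨.inl ⟨w, hw⟩, ?_, ?_⟩)
        · have : finOption L (gUnion x z) = some ⟨w, hw⟩ := finOption_eq_some.2 hgw
          simp only [fwd, h, dite_false, this, Option.map_some]
        · have : finOption P.N (fUnion x w) = some z := finOption_eq_some.2 hfw
          exact Option.bind_eq_some_iff.2 ⟨z, this, Option.bind_eq_some_iff.2 ⟨j, hj, hb⟩⟩

/-- Bernoulli: with `δ = U - A`, `(1 + δ/A)^t ≥ 1 + tδ/A ≥ 2`. -/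
theorem two_mul_pow_le_pow {A U t : ℕ} (ht : 0 < t) (hAU : A ≤ U) (h : A ≤ t * (U - A))
    (hU : 2 ≤ U) : 2 * A ^ t ≤ U ^ t := by
  rcases Nat.eq_zero_or_pos A with rfl | hA
  · simp [ht.ne']
  · obtain ⟨δ, rfl⟩ := Nat.exists_eq_add_of_le hAU
    rw [Nat.add_sub_cancel_left] at h
    have hA' : (0 : ℝ) < A := by exact_mod_cast hA
    have h₁ : (1 : ℝ) + t * (δ / A) ≤ (1 + δ / A) ^ t :=
      one_add_mul_le_pow (le_trans (by norm_num) (by positivity : (0 : ℝ) ≤ δ / A)) t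
    have h₂ : (1 : ℝ) ≤ t * (δ / A) := by
      rw [← mul_div_assoc, one_le_div hA']
      exact_mod_cast h
    have h₃ : (2 : ℝ) * A ^ t ≤ (1 + δ / A) ^ t * A ^ t :=
      mul_le_mul_of_nonneg_right (by linarith) (by positivity)
    rw [← mul_pow, add_mul, one_mul, div_mul_cancel₀ _ hA'.ne'] at h₃
    exact_mod_cast h₃

namespace InclExclParam

variable {C k : ℕ} (P : InclExclParam C k)

theorem two_le_N (hk : 1 ≤ k) : 2 ≤ P.N := by
  by_contra! h
  have h₁ : Real.logb 2 P.N = 0 := by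
    have : P.N = 0 ∨ P.N = 1 := by omega
    rcases this with h | h <;> simp [h]
  have := P.lt_ε
  rw [h₁, zero_pow (by omega)] at this
  norm_num at this

theorem one_le_logb (hk : 1 ≤ k) : 1 ≤ Real.logb 2 P.N := by
  have h := P.two_le_N hk
  rw [Real.le_logb_iff_rpow_le one_lt_two (by positivity)]
  norm_num
  exact_mod_cast h

theorem ε_pos (hk : 1 ≤ k) : 0 < P.ε := by
  have h := P.one_le_logb hk
  by_contra! h₁
  have := P.lt_ε
  have h₂ : 0 ≤ C * Real.logb 2 P.N ^ k := by positivity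
  nlinarith

end InclExclParam

open InclExclPos in
-- The domains depend on the numbers in the input, so these are queried first. If they violate the
-- assumptions, every output is a solution. Otherwise both sides are padded by `(l+1)N - ∑ a_i`
-- elements, which makes their sizes uniform and keeps the difference `εN`.
theorem hasRetraction_inclusionExclusion {C k : ℕ} (hk : 1 ≤ k) (P : InclExclParam C k)
    (hl : 0 < P.l) :
    HasRetraction (inclusionExclusion C k P) (Fin ⌊((P.l + 1 : ℕ) * P.N : ℝ) - P.ε * P.N⌋₊)
      (Fin ((P.l + 1) * P.N)) ((P.l + P.l * P.l) * Nat.clog 2 (P.N + 1) +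
        (2 * Nat.clog 2 P.N + P.l + Nat.clog 2 (P.l * P.N))) := by
  have hN := P.two_le_N hk
  have hε := P.ε_pos hk
  have : Nonempty (inclusionExclusion C k P).Out := ⟨.inr (.inr (⟨0, by omega⟩ : Fin P.N))⟩
  refine HasRetractionOn.of_fibers (θ := numbers) hasDepthLE_numbers fun c => ?_
  by_cases hc : (∀ i, c.1 i ≤ P.N) ∧ (∀ p, c.2 p ≤ P.N) ∧
      P.ε * P.N ≤ ((∑ i, (c.1 i : ℤ) - ∑ p, (c.2 p : ℤ) : ℤ) : ℝ)
  · obtain ⟨h₁, h₂, h₃⟩ := hc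
    have hsum : ∑ i, c.1 i ≤ P.l * P.N := by
      simpa using Finset.sum_le_sum fun i (_ : i ∈ Finset.univ) => h₁ i
    have hsum' : (∑ i, (c.1 i : ℝ)) ≤ P.l * P.N := by exact_mod_cast hsum
    have hL : (unionBound P c : ℝ) ≤ ∑ i, (c.1 i : ℝ) - ∑ p, (c.2 p : ℝ) - P.ε * P.N := by
      refine (Nat.floor_le (by linarith)).trans (le_of_eq ?_)
      push_cast
      rfl
    have hnn : (0 : ℝ) ≤ ∑ p, (c.2 p : ℝ) := by positivity
    have hεN : 0 ≤ P.ε * P.N := by positivity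
    have hL' : unionBound P c ≤ P.l * P.N := by
      have : (unionBound P c : ℝ) ≤ P.l * P.N := by linarith
      exact_mod_cast this
    have hsum₂ : ∑ i, c.1 i ≤ (P.l + 1) * P.N := hsum.trans (Nat.mul_le_mul_right _ (Nat.le_succ _))
    refine ((hasRetractionOn_inclusionExclusion P c.1 c.2 hl h₁ h₂ hL').sum_id
      (Fin ((P.l + 1) * P.N - ∑ i, c.1 i))).resize ?_ ?_
    · simp only [Fintype.card_sum, Fintype.card_sigma, Fintype.card_fin]
      refine Nat.le_floor ?_
      push_cast [Nat.cast_sub hsum₂]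
      linarith
    · simp only [Fintype.card_sum, Fintype.card_sigma, Fintype.card_fin]
      omega
  · refine HasRetractionOn.of_forall_rel (fun x hx o hv => (hc ?_).elim) _ _ _
    obtain ⟨h₁, h₂, h₃⟩ := hv
    have hx : numbers x = c := hx
    rw [← hx]
    exact ⟨h₁, h₂, h₃⟩

open InclExclPos in
theorem inLossy_inclusionExclusion {C k : ℕ} (hk : 1 ≤ k) :
    InLossy (inclusionExclusion C k) := by
  have hE : PolyBounded fun u => C * (u + 1) ^ k := ⟨C, k, fun _ => le_rfl⟩
  have hpoly : PolyBounded fun u => 1 +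
      (((C * (u + 1) ^ k + 1) * (C * (u + 1) ^ k)) * (C * (u + 1) ^ k + 1 + (u + 1)) +
      3 * ((C * (u + 1) ^ k + 1) * (C * (u + 1) ^ k)) *
        ((C * (u + 1) ^ k + C * (u + 1) ^ k * (C * (u + 1) ^ k)) * (u + 2) +
          (2 * (u + 1) + C * (u + 1) ^ k + (C * (u + 1) ^ k + (u + 1))))) := by
    have h := fun c => PolyBounded.id.add (PolyBounded.const c)
    have k := PolyBounded.const
    have ht := (hE.add (k 1)).mul hE
    exact (k 1).add ((ht.mul ((hE.add (k 1)).add (h 1))).add (((k 3).mul ht).mul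
      (((hE.add (hE.mul hE)).mul (h 2)).add ((((k 2).mul (h 1)).add hE).add (hE.add (h 1))))))
  refine inLossy_of_hasRetraction hpoly fun P => ?_
  have hN := P.two_le_N hk
  have hε := P.ε_pos hk
  have : Nonempty (inclusionExclusion C k P).Out := ⟨.inr (.inr (⟨0, by omega⟩ : Fin P.N))⟩
  by_cases hv : ∃ x : InclExclPos P.N P.l → Bool, Valid x P.ε
  swap
  -- Parameters without valid inputs are treated apart. They include `l = 0`, where the input length
  -- does not bound `N`; the trivial retraction avoids any such bound, and the leading 1 of the
  -- polynomial is its `Nat.clog 2 2`.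
  · refine ⟨Fin 1, Fin 2, inferInstance, inferInstance, 0,
      HasRetractionOn.of_forall_rel (fun x _ o h => (hv ⟨x, h⟩).elim) _ _ _, by simp, by simp, ?_⟩
    rw [Fintype.card_fin]
    exact (Nat.clog_le_of_le_pow (le_refl (2 ^ 1))).trans (Nat.le_add_right _ _)
  obtain ⟨x, hx₁, hx₂, hx₃⟩ := hv
  have hεl : P.ε * P.N ≤ P.l * P.N := by
    refine hx₃.trans ?_
    have h₁ : ∑ i, a x i ≤ P.l * P.N := by
      simpa using Finset.sum_le_sum fun i (_ : i ∈ Finset.univ) => hx₁ i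
    have h₂ : aTilde x ≤ (P.l * P.N : ℕ) := by
      have : (0 : ℤ) ≤ ∑ p, (a₂ x p : ℤ) := by positivity
      have h₃ : ∑ i, (a x i : ℤ) ≤ (P.l * P.N : ℕ) := by exact_mod_cast h₁
      unfold aTilde
      linarith
    exact_mod_cast h₂
  have hN0 : (0 : ℝ) < P.N := by positivity
  have hl : 0 < P.l := by
    by_contra! h
    have : P.l = 0 := by omega
    rw [this] at hεl
    have := mul_pos hε hN0
    norm_num at hεl
    linarith
  set n := (inclusionExclusion C k P).inputLength with hn
  set u := Nat.log 2 n
  have hNn : P.N ≤ n := le_card_inclExclPos hl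
  have hu : Nat.clog 2 P.N ≤ u + 1 := clog_le_log_add_one_of_le hNn
  set E := C * (u + 1) ^ k with hEdef
  have hlogE : C * Real.logb 2 P.N ^ k ≤ E := by
    have h₁ : Real.logb 2 P.N ≤ u + 1 := by
      rw [Real.logb_le_iff_le_rpow one_lt_two hN0]
      have := hNn.trans (Nat.lt_pow_succ_log_self one_lt_two n).le
      exact_mod_cast this
    have h₂ := P.one_le_logb hk
    rw [hEdef]
    push_cast
    gcongr
  have hlE : P.l ≤ E := by exact_mod_cast P.l_le.trans hlogE
  have hεE : 1 < P.ε * E := P.lt_ε.trans_le (mul_le_mul_of_nonneg_left hlogE hε.le)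
  -- The relative gap is `ε/(l+1)` and `εE > 1`, so `t` copies suffice for a factor 2 by Bernoulli.
  -- As `l ≤ E`, `t` stays polylogarithmic in the input length.
  set t := (P.l + 1) * E with ht
  have htpos : 0 < t := Nat.mul_pos (by omega) (by omega)
  have : NeZero t := ⟨htpos.ne'⟩
  refine ⟨_, _, inferInstance, inferInstance, _,
    (hasRetraction_inclusionExclusion hk P hl).pow t, ?_, ?_, ?_⟩
  · simp only [Fintype.card_fun, Fintype.card_fin]
    set A := ⌊((P.l + 1 : ℕ) * P.N : ℝ) - P.ε * P.N⌋₊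
    have hA : (A : ℝ) ≤ (P.l + 1 : ℕ) * P.N - P.ε * P.N := by
      refine Nat.floor_le ?_
      push_cast
      nlinarith
    have hAU : A ≤ (P.l + 1) * P.N := by
      have : (A : ℝ) ≤ (P.l + 1 : ℕ) * P.N := by nlinarith
      exact_mod_cast this
    refine two_mul_pow_le_pow htpos hAU ?_ (by nlinarith)
    have h₁ : (((P.l + 1) * P.N : ℕ) : ℝ) ≤ (t * ((P.l + 1) * P.N - A) : ℕ) := by
      push_cast [Nat.cast_sub hAU, ht]
      push_cast at hA
      have h₂ : P.ε * P.N ≤ (P.l + 1) * P.N - A := by linarith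
      calc ((P.l : ℝ) + 1) * P.N ≤ (P.l + 1) * P.N * (P.ε * E) :=
            le_mul_of_one_le_right (by positivity) hεE.le
        _ = (P.l + 1) * E * (P.ε * P.N) := by ring
        _ ≤ _ := by gcongr
    exact hAU.trans (by exact_mod_cast h₁)
  · simp only [Fintype.card_fun, Fintype.card_fin]
    exact (by nlinarith : 2 ≤ (P.l + 1) * P.N).trans (Nat.le_self_pow htpos.ne' _)
  · simp only [Fintype.card_fun, Fintype.card_fin]
    have htE : t ≤ (E + 1) * E := Nat.mul_le_mul_right _ (by omega)
    have hl' := clog_two_le_self P.l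
    have hl₁ := clog_two_le_self (P.l + 1)
    have hlN := clog_two_mul_le P.l P.N
    have hlN₁ := clog_two_mul_le (P.l + 1) P.N
    have hN₁ := clog_two_add_one_le P.N
    refine le_trans (add_le_add ?_ ?_) (Nat.le_add_left _ 1)
    · exact (clog_two_pow_le _ _).trans (Nat.mul_le_mul htE (by omega))
    · refine Nat.mul_le_mul (Nat.mul_le_mul_left 3 htE) (add_le_add (Nat.mul_le_mul
        (add_le_add hlE (Nat.mul_le_mul hlE hlE)) (by omega)) (by omega))

theorem mainTheorem11 :
    (∀ c : ℝ, 1 < c → LossyComplete (amgmLC c)) ∧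
    (∀ c : ℝ, 0 < c → c < 2 → LossyComplete (dualAmgmLC c)) ∧
    (∀ C k : ℕ, 1 ≤ C → 1 ≤ k → LossyComplete (inclusionExclusion C k)) :=
  ⟨fun c hc => lossyComplete_of_reduces (inLossy_amgmLC hc) (reducesDT_lossyCode_amgmLC c),
    fun _ hc hc₂ => lossyComplete_of_reduces (inLossy_dualAmgmLC hc hc₂)
      (reducesDT_lossyCode_dualAmgmLC hc hc₂),
    fun _ _ hC hk => lossyComplete_of_reduces (inLossy_inclusionExclusion hk)
      (reducesDT_lossyCode_inclusionExclusion hC hk)⟩
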